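/- An almost permutation of $\mathbb N$ is a bijection $\gamma$ between two cofinite subsets $\operatorname{dom}(\gamma)$ and $\operatorname{ran}(\gamma)$ of $\mathbb N$. It induces the automorphism $\alpha_\gamma([A])=[\gamma[A\cap\operatorname{dom}(\gamma)]]$ of the Boolean algebra $\mathcal P(\mathbb N)/\mathrm{Fin}$ (subsets of $\mathbb N$ modulo finite sets). Let $X_\gamma=(\mathbb N,d_\gamma)$, where $d_\gamma$ is the graph distance (with value $\infty$ between points of different connected components) of the graph on $\mathbb N$ in which distinct $i$ and $j$ are adjacent if and only if $\gamma(i)=j$ or $\gamma(j)=i$. Let $(\delta_i)_{i\in\mathbb N}$ be the standard basis of the complex Hilbert space $\ell_2(\mathbb N)$. A bounded operator $T$ on $\ell_2(\mathbb N)$ has finite propagation if there is $m\in\mathbb N$ such that $(T\delta_i\mid\delta_j)=0$ whenever $d_\gamma(i,j)>m$. The uniform Roe algebra $\mathrm C^*_u(X_\gamma)$ is the norm closure of the set of all operators of finite propagation, and the uniform Roe corona is the quotient $\mathrm Q^*_u(X_\gamma)=\mathrm C^*_u(X_\gamma)/(\mathrm C^*_u(X_\gamma)\cap\mathcal K(\ell_2(\mathbb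 N)))$, where $\mathcal K$ denotes the compact operators. Let $v_\gamma$ be the partial isometry of $\ell_2(\mathbb N)$ with $v_\gamma\delta_i=\delta_{\gamma(i)}$ for $i\in\operatorname{dom}(\gamma)$ and $v_\gamma\delta_i=0$ otherwise; it belongs to $\mathrm C^*_u(X_\gamma)$. Lemma. Let $\gamma$ and $\gamma'$ be almost permutations of $\mathbb N$ such that $\alpha_\gamma$ and $\alpha_{\gamma'}$ are conjugate, that is, there is an automorphism $\Phi$ of $\mathcal P(\mathbb N)/\mathrm{Fin}$ (not necessarily induced by an almost permutation) with $\Phi\circ\alpha_\gamma=\alpha_{\gamma'}\circ\Phi$. Then there is a $*$-isomorphism from $\mathrm Q^*_u(X_\gamma)$ onto $\mathrm Q^*_u(X_{\gamma'})$ that sends the image of $v_\gamma$ to the image of $v_{\gamma'}$. -/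

import Mathlib

open scoped ComplexConjugate

noncomputable section

namespace RoeCorona

/-! ### The Boolean algebra `𝒫(ℕ)/Fin` -/

/-- `A =* B`: the sets `A` and `B` differ by finitely many elements. -/
instance almostEqSetoid : Setoid (Set ℕ) where
  r A B := (symmDiff A B).Finite
  iseqv :=
    { refl := fun A => by simp
      symm := fun {A B} h => by rwa [symmDiff_comm]
      trans := fun {A B C} h h' => (h.union h').subset (symmDiff_triangle A B C) }

/-- The set underlying `𝒫(ℕ)/Fin`: classes of subsets of `ℕ` modulo finite sets. -/
def PFin : Type := Quotient almostEqSetoid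

namespace PFin

/-- The class `[A]_Fin`. -/
def mk (A : Set ℕ) : PFin := Quotient.mk almostEqSetoid A

theorem mk_eq_mk {A B : Set ℕ} : mk A = mk B ↔ (symmDiff A B).Finite := Quotient.eq

theorem ind {p : PFin → Prop} (h : ∀ A, p (mk A)) (x : PFin) : p x := Quotient.ind h x

theorem finite_diff_of_finite_symmDiff {A B : Set ℕ} (h : (symmDiff A B).Finite) :
    (A \ B).Finite := h.subset (by intro x hx; exact Or.inl hx)

/-- `[A] ≤ [B]` if and only if `B` contains all but finitely many elements of `A`. -/
protected def le : PFin → PFin → Prop :=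
  Quotient.lift₂ (fun A B : Set ℕ => (A \ B).Finite) (by
    have key : ∀ A B A' B' : Set ℕ, (symmDiff A A').Finite → (symmDiff B B').Finite →
        (A \ B).Finite → (A' \ B').Finite := by
      intro A B A' B' hA hB h
      refine ((hA.union hB).union h).subset ?_
      intro x hx
      simp only [Set.mem_union, Set.mem_symmDiff, Set.mem_sdiff] at hx ⊢
      tauto
    intro A B A' B' hA hB
    exact propext ⟨key _ _ _ _ hA hB,
      key _ _ _ _ (almostEqSetoid.symm hA) (almostEqSetoid.symm hB)⟩)

/-- The quotient Boolean algebra `𝒫(ℕ)/Fin`: all operations are computed on representatives. -/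
instance booleanAlgebra : BooleanAlgebra PFin where
  le := PFin.le
  le_refl := ind fun A => show (A \ A).Finite by simp
  le_trans := ind fun A => ind fun B => ind fun C => fun
    (h : (A \ B).Finite) (h' : (B \ C).Finite) => show (A \ C).Finite from
      (h.union h').subset (by
        intro x hx
        simp only [Set.mem_union, Set.mem_sdiff] at hx ⊢
        tauto)
  le_antisymm := ind fun A => ind fun B => fun
    (h : (A \ B).Finite) (h' : (B \ A).Finite) => mk_eq_mk.2 (h.union h')
  sup := Quotient.map₂ (fun A B : Set ℕ => A ∪ B) (by
    intro A A' (hA : (symmDiff A A').Finite) B B' (hB : (symmDiff B B').Finite)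
    refine (hA.union hB).subset ?_
    intro x hx
    simp only [Set.mem_union, Set.mem_symmDiff] at hx ⊢
    tauto)
  inf := Quotient.map₂ (fun A B : Set ℕ => A ∩ B) (by
    intro A A' (hA : (symmDiff A A').Finite) B B' (hB : (symmDiff B B').Finite)
    refine (hA.union hB).subset ?_
    intro x hx
    simp only [Set.mem_union, Set.mem_inter_iff, Set.mem_symmDiff] at hx ⊢
    tauto)
  compl := Quotient.map (fun A : Set ℕ => Aᶜ) (by
    intro A A' (hA : (symmDiff A A').Finite)
    refine hA.subset ?_
    intro x hx
    simp only [Set.mem_compl_iff, Set.mem_symmDiff] at hx ⊢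
    tauto)
  top := mk Set.univ
  bot := mk ∅
  le_sup_left := ind fun A => ind fun B => show (A \ (A ∪ B)).Finite by
    rw [Set.sdiff_eq_empty.2 Set.subset_union_left]; exact Set.finite_empty
  le_sup_right := ind fun A => ind fun B => show (B \ (A ∪ B)).Finite by
    rw [Set.sdiff_eq_empty.2 Set.subset_union_right]; exact Set.finite_empty
  sup_le := ind fun A => ind fun B => ind fun C => fun
    (h : (A \ C).Finite) (h' : (B \ C).Finite) => show ((A ∪ B) \ C).Finite by
      rw [Set.union_sdiff_distrib]; exact h.union h'
  inf_le_left := ind fun A => ind fun B => show ((A ∩ B) \ A).Finite by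
    rw [Set.sdiff_eq_empty.2 Set.inter_subset_left]; exact Set.finite_empty
  inf_le_right := ind fun A => ind fun B => show ((A ∩ B) \ B).Finite by
    rw [Set.sdiff_eq_empty.2 Set.inter_subset_right]; exact Set.finite_empty
  le_inf := ind fun A => ind fun B => ind fun C => fun
    (h : (A \ B).Finite) (h' : (A \ C).Finite) => show (A \ (B ∩ C)).Finite by
      rw [Set.sdiff_inter]; exact h.union h'
  le_sup_inf := ind fun A => ind fun B => ind fun C =>
    show (((A ∪ B) ∩ (A ∪ C)) \ (A ∪ (B ∩ C))).Finite by
      rw [← Set.union_inter_distrib_left]; simp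
  inf_compl_le_bot := ind fun A => show ((A ∩ Aᶜ) \ ∅).Finite by simp
  top_le_sup_compl := ind fun A => show (Set.univ \ (A ∪ Aᶜ)).Finite by simp
  le_top := ind fun A => show (A \ Set.univ).Finite by simp
  bot_le := ind fun A => show (∅ \ A).Finite by simp

theorem mk_le_mk {A B : Set ℕ} : mk A ≤ mk B ↔ (A \ B).Finite := Iff.rfl

end PFin

/-! ### Almost permutations and the automorphisms they induce -/

/-- An almost permutation of `ℕ`: a bijection between two cofinite subsets of `ℕ`, its domain
`source` and its range `target`. -/
structure AlmostPerm extends PartialEquiv ℕ ℕ where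
  finite_compl_source : sourceᶜ.Finite
  finite_compl_target : targetᶜ.Finite

namespace AlmostPerm

/-- The inverse almost permutation. -/
def inv (γ : AlmostPerm) : AlmostPerm where
  toPartialEquiv := γ.toPartialEquiv.symm
  finite_compl_source := γ.finite_compl_target
  finite_compl_target := γ.finite_compl_source

/-- The image `γ[A] = {γ(n) : n ∈ A ∩ dom γ}`. -/
def image (γ : AlmostPerm) (A : Set ℕ) : Set ℕ := γ.toPartialEquiv '' (A ∩ γ.source)

theorem image_diff_subset (γ : AlmostPerm) (A B : Set ℕ) :
    γ.image A \ γ.image B ⊆ γ.image (A \ B) := by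
  rintro _ ⟨⟨n, ⟨hA, hs⟩, rfl⟩, h⟩
  exact ⟨n, ⟨⟨hA, fun hB => h ⟨n, ⟨hB, hs⟩, rfl⟩⟩, hs⟩, rfl⟩

theorem finite_image (γ : AlmostPerm) {A : Set ℕ} (h : A.Finite) : (γ.image A).Finite :=
  (h.subset Set.inter_subset_left).image _

/-- The map `[A] ↦ [γ[A]]` on `𝒫(ℕ)/Fin`. -/
def act (γ : AlmostPerm) : PFin → PFin :=
  Quotient.map γ.image (by
    intro A B (h : (symmDiff A B).Finite)
    refine (γ.finite_image h).subset ?_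
    rintro x (hx | hx)
    · obtain ⟨n, hn, rfl⟩ := γ.image_diff_subset A B hx
      exact ⟨n, ⟨Or.inl hn.1, hn.2⟩, rfl⟩
    · obtain ⟨n, hn, rfl⟩ := γ.image_diff_subset B A hx
      exact ⟨n, ⟨Or.inr hn.1, hn.2⟩, rfl⟩)

@[simp] theorem act_mk (γ : AlmostPerm) (A : Set ℕ) : γ.act (PFin.mk A) = PFin.mk (γ.image A) := rfl

theorem act_mono (γ : AlmostPerm) : Monotone γ.act :=
  PFin.ind fun A => PFin.ind fun B => fun h =>
    (γ.finite_image (PFin.mk_le_mk.1 h)).subset (γ.image_diff_subset A B)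

theorem inv_image_image (γ : AlmostPerm) (A : Set ℕ) : γ.inv.image (γ.image A) = A ∩ γ.source := by
  ext n
  constructor
  · rintro ⟨_, ⟨⟨m, ⟨hA, hs⟩, rfl⟩, _⟩, rfl⟩
    have : γ.inv.toPartialEquiv (γ.toPartialEquiv m) = m := γ.left_inv hs
    rw [this]
    exact ⟨hA, hs⟩
  · rintro ⟨hA, hs⟩
    exact ⟨γ.toPartialEquiv n, ⟨⟨n, ⟨hA, hs⟩, rfl⟩, γ.map_source hs⟩, γ.left_inv hs⟩

theorem act_inv_act (γ : AlmostPerm) : Function.LeftInverse γ.inv.act γ.act :=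
  PFin.ind fun A => by
    rw [act_mk, act_mk, inv_image_image, PFin.mk_eq_mk]
    refine γ.finite_compl_source.subset ?_
    intro x hx
    simp only [Set.mem_symmDiff, Set.mem_inter_iff, Set.mem_compl_iff] at hx ⊢
    tauto

/-- The trivial automorphism `α_γ` of `𝒫(ℕ)/Fin` induced by `γ`, i.e. `α_γ [A] = [γ[A]]`.
(An automorphism of a Boolean algebra is the same as an order automorphism of it.) -/
def aut (γ : AlmostPerm) : PFin ≃o PFin where
  toFun := γ.act
  invFun := γ.inv.act
  left_inv := γ.act_inv_act
  right_inv := γ.inv.act_inv_act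
  map_rel_iff' := fun {a b} =>
    ⟨fun h => by
      have : γ.inv.act (γ.act a) ≤ γ.inv.act (γ.act b) := γ.inv.act_mono h
      rwa [γ.act_inv_act a, γ.act_inv_act b] at this,
     fun h => γ.act_mono h⟩

/-! ### The space `X_γ` -/

/-- The graph on `ℕ` in which `i ≠ j` are adjacent iff `γ(i) = j` or `γ(j) = i`. -/
def graph (γ : AlmostPerm) : SimpleGraph ℕ :=
  SimpleGraph.fromRel fun i j => i ∈ γ.source ∧ γ.toPartialEquiv i = j

/-- The graph distance `d_γ`; it is `⊤` between points of different orbits. -/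
def dist (γ : AlmostPerm) (i j : ℕ) : ℕ∞ := γ.graph.edist i j

end AlmostPerm

/-- An automorphism `α` of `𝒫(ℕ)/Fin` is conjugate to `β` if `Φ ∘ α = β ∘ Φ` for some
automorphism `Φ` of `𝒫(ℕ)/Fin`, trivial or not. -/
def Conjugate (α β : PFin ≃o PFin) : Prop :=
  ∃ Φ : PFin ≃o PFin, ∀ x, Φ (α x) = β (Φ x)

/-! ### Operators on `ℓ²(ℕ)` -/

/-- The complex Hilbert space `ℓ²(ℕ)`. -/
abbrev H : Type := lp (fun _ : ℕ => ℂ) 2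

/-- The standard basis vector `δ_i`. -/
def δ (i : ℕ) : H := lp.single 2 i (1 : ℂ)

theorem δ_apply (i j : ℕ) : δ i j = if j = i then 1 else 0 := by
  simp [δ, lp.single_apply, Pi.single_apply]

theorem inner_δ_left (i : ℕ) (x : H) : inner ℂ (δ i) x = x i := by
  simp [δ, lp.inner_single_left]

theorem inner_δ_right (i : ℕ) (x : H) : inner ℂ x (δ i) = conj (x i) := by
  simp [δ, lp.inner_single_right]

/-- The operator `T` has `γ`-propagation at most `m`: whenever `d_γ(i,j) > m`, the matrix entry
of `T` at `i, j` vanishes. -/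
def HasPropagation (γ : AlmostPerm) (m : ℕ) (T : H →L[ℂ] H) : Prop :=
  ∀ i j : ℕ, (m : ℕ∞) < γ.dist i j → inner ℂ (T (δ i)) (δ j) = 0

theorem HasPropagation.apply_eq_zero {γ : AlmostPerm} {m : ℕ} {T : H →L[ℂ] H}
    (h : HasPropagation γ m T) {i j : ℕ} (hij : (m : ℕ∞) < γ.dist i j) : T (δ i) j = 0 := by
  simpa [inner_δ_right] using h i j hij

theorem HasPropagation.mono {γ : AlmostPerm} {m n : ℕ} {T : H →L[ℂ] H}
    (h : HasPropagation γ m T) (hmn : m ≤ n) : HasPropagation γ n T :=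
  fun i j hij => h i j (lt_of_le_of_lt (by exact_mod_cast hmn) hij)

theorem HasPropagation.add {γ : AlmostPerm} {m n : ℕ} {S T : H →L[ℂ] H}
    (hS : HasPropagation γ m S) (hT : HasPropagation γ n T) :
    HasPropagation γ (max m n) (S + T) := fun i j hij => by
  rw [add_apply, inner_add_left, hS.mono (le_max_left m n) i j hij,
    hT.mono (le_max_right m n) i j hij, add_zero]

theorem HasPropagation.adjoint {γ : AlmostPerm} {m : ℕ} {T : H →L[ℂ] H}
    (h : HasPropagation γ m T) : HasPropagation γ m (star T) := fun i j hij => by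
  rw [ContinuousLinearMap.star_eq_adjoint, ContinuousLinearMap.adjoint_inner_left,
    ← inner_conj_symm, h j i (by rwa [AlmostPerm.dist, SimpleGraph.edist_comm]), map_zero]

theorem HasPropagation.mul {γ : AlmostPerm} {m n : ℕ} {S T : H →L[ℂ] H}
    (hS : HasPropagation γ m S) (hT : HasPropagation γ n T) :
    HasPropagation γ (n + m) (S * T) := fun i j hij => by
  rw [mul_apply_eq_comp, ← ContinuousLinearMap.adjoint_inner_right]
  have h := lp.hasSum_inner (𝕜 := ℂ) (T (δ i)) (ContinuousLinearMap.adjoint S (δ j))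
  rw [← h.tsum_eq]
  refine (tsum_congr fun k => ?_).trans tsum_zero
  by_cases hk : (n : ℕ∞) < γ.dist i k
  · rw [hT.apply_eq_zero hk, inner_zero_left]
  · have hk' : (m : ℕ∞) < γ.dist j k := by
      by_contra hc
      refine absurd hij (not_lt.2 ?_)
      calc γ.dist i j ≤ γ.dist i k + γ.dist k j := γ.graph.edist_triangle
        _ ≤ n + m := add_le_add (not_lt.1 hk) (by
            rw [AlmostPerm.dist, SimpleGraph.edist_comm]; exact not_lt.1 hc)
        _ = ((n + m : ℕ) : ℕ∞) := by push_cast; rfl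
    have := hS.adjoint.apply_eq_zero hk'
    rw [ContinuousLinearMap.star_eq_adjoint] at this
    rw [this, inner_zero_right]

theorem hasPropagation_algebraMap (γ : AlmostPerm) (c : ℂ) :
    HasPropagation γ 0 (algebraMap ℂ (H →L[ℂ] H) c) := fun i j hij => by
  have hne : j ≠ i := by
    rintro rfl
    simp [AlmostPerm.dist] at hij
  simp [Algebra.algebraMap_eq_smul_one, inner_δ_right, δ_apply, hne]

/-! ### Uniform Roe algebras -/

/-- The algebraic uniform Roe algebra `C*_u[X_γ]`: the operators of finite propagation. -/
def algUniformRoe (γ : AlmostPerm) : StarSubalgebra ℂ (H →L[ℂ] H) where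
  carrier := {T | ∃ m : ℕ, HasPropagation γ m T}
  mul_mem' := fun ⟨_, hS⟩ ⟨_, hT⟩ => ⟨_, hS.mul hT⟩
  add_mem' := fun ⟨_, hS⟩ ⟨_, hT⟩ => ⟨_, hS.add hT⟩
  algebraMap_mem' := fun c => ⟨0, hasPropagation_algebraMap γ c⟩
  star_mem' := fun ⟨_, hT⟩ => ⟨_, hT.adjoint⟩

/-- The uniform Roe algebra `C*_u(X_γ)`: the norm closure of `C*_u[X_γ]`. -/
def uniformRoe (γ : AlmostPerm) : StarSubalgebra ℂ (H →L[ℂ] H) :=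
  (algUniformRoe γ).topologicalClosure

/-! ### Compact operators and the uniform Roe corona -/

/-- The adjoint of a compact operator is compact. -/
theorem isCompactOperator_star {T : H →L[ℂ] H} (hT : IsCompactOperator T) :
    IsCompactOperator (star T : H →L[ℂ] H) := by
  have hc : IsCompactOperator (fun x => T ((star T : H →L[ℂ] H) x)) :=
    IsCompactOperator.comp_clm (f := (T : H → H)) hT (star T : H →L[ℂ] H)
  have hb : TotallyBounded ((fun x => T ((star T : H →L[ℂ] H) x)) '' Metric.closedBall 0 1) := by
    obtain ⟨K, hK, hsub⟩ := IsCompactOperator.image_closedBall_subset_compact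
      (f := ((T * star T : H →L[ℂ] H) : H →ₗ[ℂ] H)) hc 1
    exact hK.totallyBounded.subset hsub
  refine (isCompactOperator_iff_isCompact_closure_image_closedBall
    ((star T : H →L[ℂ] H) : H →ₗ[ℂ] H) one_pos).2 ?_
  refine TotallyBounded.isCompact_of_isClosed (TotallyBounded.closure ?_) isClosed_closure
  rw [Metric.totallyBounded_iff]
  intro ε hε
  obtain ⟨t, hts, htf, ht⟩ := (totallyBounded_iff_subset.1 hb) _
    (Metric.dist_mem_uniformity (show (0 : ℝ) < ε ^ 2 / 2 by positivity))
  obtain ⟨u, hu, huf, hcov⟩ := Set.exists_subset_image_finite_and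
    (p := fun t => _ '' Metric.closedBall (0 : H) 1 ⊆
      ⋃ y ∈ t, {x | (x, y) ∈ {p : H × H | Dist.dist p.1 p.2 < ε ^ 2 / 2}}).1 ⟨t, hts, htf, ht⟩
  refine ⟨(star T : H →L[ℂ] H) '' u, huf.image _, ?_⟩
  rintro _ ⟨x, hx, rfl⟩
  obtain ⟨_, ⟨y, hy, rfl⟩, hxy⟩ := Set.mem_iUnion₂.1 (hcov ⟨x, hx, rfl⟩)
  refine Set.mem_iUnion₂.2 ⟨_, ⟨y, hy, rfl⟩, ?_⟩
  have hd : ‖T ((star T : H →L[ℂ] H) (x - y))‖ < ε ^ 2 / 2 := by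
    have h0 : Dist.dist (T ((star T : H →L[ℂ] H) x)) (T ((star T : H →L[ℂ] H) y)) < ε ^ 2 / 2 := hxy
    rwa [dist_eq_norm, ← map_sub, ← map_sub] at h0
  have hn : ‖x - y‖ ≤ 2 := by
    have h1 := mem_closedBall_zero_iff.1 hx
    have h2 := mem_closedBall_zero_iff.1 (hu hy)
    linarith [norm_sub_le x y]
  have hsq : ‖(star T : H →L[ℂ] H) (x - y)‖ ^ 2 ≤
      ‖T ((star T : H →L[ℂ] H) (x - y))‖ * ‖x - y‖ := by
    rw [← inner_self_eq_norm_sq (𝕜 := ℂ)]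
    refine (RCLike.re_le_norm _).trans ?_
    rw [ContinuousLinearMap.star_eq_adjoint, ContinuousLinearMap.adjoint_inner_right]
    exact norm_inner_le_norm _ _
  rw [Metric.mem_ball, dist_eq_norm]
  change ‖(star T : H →L[ℂ] H) x - (star T : H →L[ℂ] H) y‖ < ε
  rw [← map_sub]
  refine lt_of_pow_lt_pow_left₀ 2 hε.le (hsq.trans_lt ?_)
  nlinarith [norm_nonneg (x - y), norm_nonneg (T ((star T : H →L[ℂ] H) (x - y)))]

/-- The ideal `C*_u(X_γ) ∩ 𝒦(ℓ²(ℕ))` of compact operators in `C*_u(X_γ)`. -/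
def compactIdeal (γ : AlmostPerm) : Ideal (uniformRoe γ) where
  carrier := {T | IsCompactOperator (T : H →L[ℂ] H)}
  add_mem' := fun {S T} hS hT => IsCompactOperator.add (f := (S : H →L[ℂ] H)) hS hT
  zero_mem' := isCompactOperator_zero
  smul_mem' := fun S _ hT =>
    IsCompactOperator.clm_comp hT (S : H →L[ℂ] H)

theorem mem_compactIdeal {γ : AlmostPerm} {T : uniformRoe γ} :
    T ∈ compactIdeal γ ↔ IsCompactOperator (T : H →L[ℂ] H) := Iff.rfl

instance compactIdeal_isTwoSided (γ : AlmostPerm) : (compactIdeal γ).IsTwoSided where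
  mul_mem_of_left := fun {S} T hS =>
    IsCompactOperator.comp_clm (f := ((S : H →L[ℂ] H) : H → H)) hS (T : H →L[ℂ] H)

/-- The uniform Roe corona `Q*_u(X_γ) = C*_u(X_γ) / (C*_u(X_γ) ∩ 𝒦(ℓ²(ℕ)))`. -/
abbrev Corona (γ : AlmostPerm) : Type := uniformRoe γ ⧸ compactIdeal γ

/-- The image `Ṫ` of `T ∈ C*_u(X_γ)` in the corona. -/
def toCorona (γ : AlmostPerm) : uniformRoe γ →ₐ[ℂ] Corona γ := Ideal.Quotient.mkₐ ℂ (compactIdeal γ)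

/-- The involution of the corona, `Ṫ* = (T*)˙`. -/
instance coronaStarRing (γ : AlmostPerm) : StarRing (Corona γ) where
  star := Quotient.lift (fun T : uniformRoe γ => toCorona γ (star T)) (by
    intro S T h
    have h' : S - T ∈ compactIdeal γ := (Submodule.quotientRel_def _).1 h
    refine Ideal.Quotient.eq.2 ?_
    rw [← star_sub, mem_compactIdeal]
    exact isCompactOperator_star h')
  star_involutive := Quotient.ind fun T => congrArg (toCorona γ) (star_star T)
  star_mul := Quotient.ind fun S => Quotient.ind fun T => by
    exact (congrArg (toCorona γ) (star_mul S T)).trans (map_mul (toCorona γ) _ _)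
  star_add := Quotient.ind fun S => Quotient.ind fun T => by
    exact (congrArg (toCorona γ) (star_add S T)).trans (map_add (toCorona γ) _ _)

theorem star_toCorona (γ : AlmostPerm) (T : uniformRoe γ) :
    star (toCorona γ T) = toCorona γ (star T) := rfl

/-! ### The partial isometry `v_γ` -/

/-- The coordinates of `v_γ x`. -/
def shiftFun (γ : AlmostPerm) (x : ℕ → ℂ) (j : ℕ) : ℂ :=
  open Classical in if j ∈ γ.target then x (γ.toPartialEquiv.symm j) else 0

theorem sum_shiftFun_le (γ : AlmostPerm) (x : H) (s : Finset ℕ) :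
    ∑ j ∈ s, ‖shiftFun γ x j‖ ^ (2 : ENNReal).toReal ≤ ‖x‖ ^ (2 : ENNReal).toReal := by
  classical
  have hinj : Set.InjOn γ.toPartialEquiv.symm ↑(s.filter (· ∈ γ.target)) := by
    intro i hi j hj h
    simp only [Finset.coe_filter, Set.mem_ofPred_eq] at hi hj
    exact γ.toPartialEquiv.symm.injOn hi.2 hj.2 h
  calc ∑ j ∈ s, ‖shiftFun γ x j‖ ^ (2 : ENNReal).toReal
      = ∑ j ∈ s.filter (· ∈ γ.target),
          ‖x (γ.toPartialEquiv.symm j)‖ ^ (2 : ENNReal).toReal := by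
        rw [Finset.sum_filter]
        refine Finset.sum_congr rfl fun j _ => ?_
        by_cases hj : j ∈ γ.target <;> simp [shiftFun, hj]
    _ = ∑ i ∈ (s.filter (· ∈ γ.target)).image γ.toPartialEquiv.symm,
          ‖x i‖ ^ (2 : ENNReal).toReal := by
        rw [Finset.sum_image hinj]
    _ ≤ ‖x‖ ^ (2 : ENNReal).toReal := lp.sum_rpow_le_norm_rpow (by simp) x _

/-- The partial isometry `v_γ` of `ℓ²(ℕ)`: `v_γ δ_i = δ_{γ(i)}` if `i` is in the domain of `γ`,
and `v_γ δ_i = 0` otherwise. -/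
def v (γ : AlmostPerm) : H →L[ℂ] H :=
  LinearMap.mkContinuous
    { toFun := fun x => ⟨shiftFun γ x, memℓp_gen' (sum_shiftFun_le γ x)⟩
      map_add' := fun x y => by
        ext j
        simp only [shiftFun, lp.coeFn_add, Pi.add_apply]
        split_ifs <;> simp
      map_smul' := fun c x => by
        ext j
        simp only [shiftFun, lp.coeFn_smul, Pi.smul_apply, RingHom.id_apply]
        split_ifs <;> simp }
    1 (fun x => by
      rw [one_mul]
      exact lp.norm_le_of_forall_sum_le (by simp) (norm_nonneg x) (sum_shiftFun_le γ x))

theorem v_apply (γ : AlmostPerm) (x : H) (j : ℕ) : v γ x j = shiftFun γ x j := rfl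

/-- `v_γ δ_i = δ_{γ(i)}` for `i` in the domain of `γ`. -/
theorem v_δ_of_mem (γ : AlmostPerm) {i : ℕ} (hi : i ∈ γ.source) :
    v γ (δ i) = δ (γ.toPartialEquiv i) := by
  ext j
  rw [v_apply, shiftFun, δ_apply, δ_apply]
  by_cases hj : j ∈ γ.target
  · rw [if_pos hj]
    refine if_congr ?_ rfl rfl
    constructor
    · rintro rfl
      exact (γ.right_inv hj).symm
    · rintro rfl
      exact γ.left_inv hi
  · rw [if_neg hj, if_neg]
    rintro rfl
    exact hj (γ.map_source hi)

/-- `v_γ δ_i = 0` for `i` outside the domain of `γ`. -/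
theorem v_δ_of_notMem (γ : AlmostPerm) {i : ℕ} (hi : i ∉ γ.source) : v γ (δ i) = 0 := by
  ext j
  rw [v_apply, shiftFun, δ_apply]
  by_cases hj : j ∈ γ.target
  · rw [if_pos hj, if_neg]
    · rfl
    · rintro rfl
      exact hi (γ.map_target hj)
  · rw [if_neg hj]; rfl

theorem hasPropagation_v (γ : AlmostPerm) : HasPropagation γ 1 (v γ) := by
  intro i j hij
  by_cases hi : i ∈ γ.source
  · rw [v_δ_of_mem γ hi, inner_δ_right, δ_apply, if_neg, map_zero]
    rintro rfl
    refine absurd hij (not_lt.2 ?_)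
    rw [AlmostPerm.dist, Nat.cast_one, SimpleGraph.edist_le_one_iff_adj_or_eq]
    by_cases h : i = γ.toPartialEquiv i
    · exact Or.inr h
    · exact Or.inl ⟨h, Or.inl ⟨hi, rfl⟩⟩
  · rw [v_δ_of_notMem γ hi, inner_zero_left]

theorem v_mem_uniformRoe (γ : AlmostPerm) : v γ ∈ uniformRoe γ :=
  (algUniformRoe γ).le_topologicalClosure ⟨1, hasPropagation_v γ⟩

/-- The image of `v_γ` in the corona of `X_γ`. -/
def vdot (γ : AlmostPerm) : Corona γ := toCorona γ ⟨v γ, v_mem_uniformRoe γ⟩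

end RoeCorona

end

/-! Since Φ need not come from a map of ℕ, no unitary implements it, and the isomorphism is obtained
from a correspondence between operators. Call partial bijections p and q corresponding if they are
built in parallel from (γ, γ') and from identities on sets A, B with Φ[A] = [B], by composition and
inversion. Let D be the C*-algebra of pairs of operators generated by all (V p, V q). It contains
(v_γ, v_γ'). Each coordinate maps D onto the whole uniform Roe algebra (`exists_mem_corrCStar`): the
range of a *-homomorphism of C*-algebras is closed, and it contains the diagonal operators and the
partial isometries of words in γ, which together produce every operator of finite propagation. So
the coronas are quotients of D, and it suffices that for (S, T) in D the operator S is compact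
exactly when T is (`isCompactOperator_of_mem_corrCStar`). Two facts give this. First, an element T
of the uniform Roe algebra is compact as soon as the diagonal entries of all v^j T v*^i tend to zero
(`isCompactOperator_of_tendsto_diag`). This is an amenability argument: uniform measures on orbit
segments of length n are almost invariant, so T is close to an average of compressions to sets of at
most n points whose orbits meet, where the entries of T are such diagonal entries. Second, vanishing
of diagonals passes from S to T (`tendsto_diag_of_mem_corrCStar`): the diagonal of V p is the
indicator of the fixed points of p, and Φ carries the class of that set to the class of the fixed
points of q (`Intertwines.mk_fix`). -/

/-! ### C*-algebra preliminaries: lifts, closed ranges and quotients by equal kernels. -/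

/-- An element of the range of a `*`-homomorphism of C⋆-algebras lifts without increasing its norm. -/
theorem StarAlgHom.exists_lift_norm_le {A B : Type*} [CStarAlgebra A] [CStarAlgebra B]
    (φ : A →⋆ₐ[ℂ] B) (a : A) {c : ℝ} (hc : 0 < c) (ha : ‖φ a‖ ≤ c) :
    ∃ a' : A, φ a' = φ a ∧ ‖a'‖ ≤ c := by
  -- Multiplying a by f(a*a) cuts its singular values down to c. Those of φ(a) are already at most
  -- c, so f is 1 on the spectrum of φ(a)*φ(a) and the image does not change.
  let f : ℝ → ℝ := fun t => c / max c (Real.sqrt t)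
  have hmax : ∀ t : ℝ, 0 < max c (Real.sqrt t) := fun t => lt_max_of_lt_left hc
  have hf : Continuous f :=
    continuous_const.div (by fun_prop) fun t => (hmax t).ne'
  have key : star (a * cfc f (star a * a)) * (a * cfc f (star a * a)) =
      cfc (fun t => f t * t * f t) (star a * a) := by
    have h1 : IsSelfAdjoint (cfc f (star a * a)) := cfc_predicate _ _
    have h2 : IsSelfAdjoint (star a * a) := IsSelfAdjoint.star_mul_self a
    rw [cfc_mul (fun t => f t * t) f _ (by fun_prop) (by fun_prop),
      cfc_mul f (fun t => t) _ (by fun_prop) (by fun_prop), cfc_id' ℝ (star a * a), star_mul,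
      h1.star_eq]
    simp only [mul_assoc]
  refine ⟨a * cfc f (star a * a), ?_, ?_⟩
  · have hφ : Continuous φ := AddMonoidHomClass.continuous_of_bound φ 1 fun x => by
      simpa using NonUnitalStarAlgHom.norm_apply_le φ x
    have hs : IsSelfAdjoint (star a * a) := IsSelfAdjoint.star_mul_self a
    have h2 : IsSelfAdjoint (star (φ a) * φ a) := IsSelfAdjoint.star_mul_self _
    rw [map_mul, StarAlgHomClass.map_cfc φ f (star a * a) (by fun_prop) hφ hs
      (by rw [map_mul, map_star]; exact h2), map_mul, map_star]
    have : cfc f (star (φ a) * φ a) = cfc (fun _ => (1 : ℝ)) (star (φ a) * φ a) := by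
      refine cfc_congr fun t ht => ?_
      have h3 : t ≤ c ^ 2 := by
        rcases subsingleton_or_nontrivial B with hB | hB
        · simp at ht
        refine (le_abs_self t).trans ((spectrum.norm_le_norm_of_mem ht).trans ?_)
        rw [CStarRing.norm_star_mul_self]
        nlinarith [norm_nonneg (φ a)]
      have h4 : Real.sqrt t ≤ c := Real.sqrt_le_iff.2 ⟨hc.le, h3⟩
      simp only [f, max_eq_left h4, div_self hc.ne']
    rw [this, cfc_const_one ℝ _, mul_one]
  · rw [← abs_of_pos hc, ← abs_of_nonneg (norm_nonneg (a * _)), ← sq_le_sq, sq (‖_‖),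
      ← CStarRing.norm_star_mul_self, key]
    refine norm_cfc_le (by positivity) fun t ht => ?_
    have h0 : 0 ≤ t := spectrum_star_mul_self_nonneg t ht
    have hp := hmax t
    have e : f t * t * f t = c ^ 2 * (t / (max c (Real.sqrt t)) ^ 2) := by
      simp only [f]; field_simp
    rw [e, Real.norm_of_nonneg (by positivity)]
    refine mul_le_of_le_one_right (by positivity) ((div_le_one (by positivity)).2 ?_)
    calc t = Real.sqrt t ^ 2 := (Real.sq_sqrt h0).symm
      _ ≤ _ := pow_le_pow_left₀ (Real.sqrt_nonneg t) (le_max_right _ _) 2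

/-- The range of a `*`-homomorphism of C⋆-algebras is closed. -/
theorem StarAlgHom.isClosed_range {A B : Type*} [CStarAlgebra A] [CStarAlgebra B]
    (φ : A →⋆ₐ[ℂ] B) : IsClosed (Set.range φ) := by
  let f : NormedAddGroupHom A B :=
    { toFun := φ
      map_add' := map_add φ
      bound' := ⟨1, fun a => by simpa using NonUnitalStarAlgHom.norm_apply_le φ a⟩ }
  -- Lifts with norm constant 1 allow a limit of range elements to be lifted as a convergent series
  -- in the complete domain.
  have h : f.SurjectiveOnWith f.range 1 := by
    rintro _ ⟨a, rfl⟩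
    rcases (norm_nonneg (f a)).eq_or_lt with h0 | h0
    · exact ⟨0, by rw [map_zero]; exact (norm_eq_zero.1 h0.symm).symm, by simp⟩
    · obtain ⟨a', h1, h2⟩ := φ.exists_lift_norm_le a h0 le_rfl
      exact ⟨a', h1, by rwa [one_mul]⟩
  refine isClosed_of_closure_subset fun b hb => ?_
  obtain ⟨a, ha, -⟩ := controlled_closure_of_complete one_pos one_pos h b
    (show b ∈ f.range.topologicalClosure from hb)
  exact ⟨a, ha⟩

/-- Surjective `*`-homomorphisms with the same kernel have isomorphic ranges. -/
theorem exists_starAlgEquiv_of_ker_eq {A B C : Type*} [Ring A] [StarRing A] [Algebra ℂ A]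
    [Ring B] [StarRing B] [Algebra ℂ B] [Ring C] [StarRing C] [Algebra ℂ C]
    (q : A →⋆ₐ[ℂ] B) (r : A →⋆ₐ[ℂ] C) (hq : Function.Surjective q) (hr : Function.Surjective r)
    (h : ∀ a, q a = 0 ↔ r a = 0) : ∃ e : B ≃⋆ₐ[ℂ] C, ∀ a, e (q a) = r a := by
  have h1 : ∀ a a', q a = q a' ↔ r a = r a' := fun a a' => by
    rw [← sub_eq_zero, ← map_sub, h, map_sub, sub_eq_zero]
  -- The sections s and t are mere functions. Equality of kernels makes r ∘ s and q ∘ t independent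
  -- of the choices, so every identity can be checked on elements q a or r a.
  let s := Function.surjInv hq
  let t := Function.surjInv hr
  have hs : ∀ a, r (s (q a)) = r a := fun a => (h1 _ _).1 (Function.surjInv_eq hq (q a))
  have ht : ∀ a, q (t (r a)) = q a := fun a => (h1 _ _).2 (Function.surjInv_eq hr (r a))
  refine ⟨{ toFun := fun b => r (s b)
            invFun := fun c => q (t c)
            left_inv := ?_, right_inv := ?_, map_mul' := ?_, map_add' := ?_,
            map_star' := ?_, map_smul' := ?_ }, hs⟩
  · intro b
    obtain ⟨a, rfl⟩ := hq b
    simp only [hs, ht]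
  · intro c
    obtain ⟨a, rfl⟩ := hr c
    simp only [hs, ht]
  · intro b b'
    obtain ⟨a, rfl⟩ := hq b
    obtain ⟨a', rfl⟩ := hq b'
    rw [← map_mul, hs, hs, hs, map_mul]
  · intro b b'
    obtain ⟨a, rfl⟩ := hq b
    obtain ⟨a', rfl⟩ := hq b'
    rw [← map_add, hs, hs, hs, map_add]
  · intro b
    obtain ⟨a, rfl⟩ := hq b
    simp only [← map_star, hs]
  · intro c b
    obtain ⟨a, rfl⟩ := hq b
    simp only [← map_smul, hs]

noncomputable section

namespace RoeCorona

/-! ### Partial bijections and an automorphism of `𝒫(ℕ)/Fin` -/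

/-- The image of `A` under the partial bijection `p`. -/
def pimage (p : PartialEquiv ℕ ℕ) (A : Set ℕ) : Set ℕ := p '' (A ∩ p.source)

/-- The set of fixed points of the partial bijection `p`. -/
def fix (p : PartialEquiv ℕ ℕ) : Set ℕ := {x | x ∈ p.source ∧ p x = x}

theorem pimage_trans (p q : PartialEquiv ℕ ℕ) (A : Set ℕ) :
    pimage (p.trans q) A = pimage q (pimage p A) := by
  ext y
  simp only [pimage, Set.mem_image, Set.mem_inter_iff, PartialEquiv.trans_source,
    Set.mem_preimage, PartialEquiv.coe_trans, Function.comp_apply]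
  constructor
  · rintro ⟨x, ⟨hA, hp, hq⟩, rfl⟩
    exact ⟨p x, ⟨⟨x, ⟨hA, hp⟩, rfl⟩, hq⟩, rfl⟩
  · rintro ⟨_, ⟨⟨x, ⟨hA, hp⟩, rfl⟩, hq⟩, rfl⟩
    exact ⟨x, ⟨hA, hp, hq⟩, rfl⟩

theorem pimage_ofSet (A C : Set ℕ) : pimage (PartialEquiv.ofSet A) C = C ∩ A := by
  simp [pimage]

/-- An infinite set without fixed points of `p` has an infinite subset disjoint from its image. -/
theorem exists_infinite_disjoint_pimage (p : PartialEquiv ℕ ℕ) {A : Set ℕ} (hA : A.Infinite)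
    (hfix : Disjoint A (fix p)) :
    ∃ C ⊆ A, C.Infinite ∧ Disjoint C (pimage p C) := by
  classical
  -- Greedy choice: each new point avoids the earlier points, their images and their preimages. Both
  -- directions are needed, since p may send an earlier point to a later one or the reverse; p
  -- mapping a point to itself is excluded by `hfix`.
  obtain ⟨f, hfA, hf⟩ := exists_seq_of_forall_finset_exists (fun x => x ∈ A)
    (fun x y => x ≠ y ∧ p x ≠ y ∧ p.symm x ≠ y) (fun s _ => by
      obtain ⟨y, hy, hys⟩ := hA.exists_notMem_finset (s ∪ s.image p ∪ s.image p.symm)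
      simp only [Finset.mem_union, Finset.mem_image, not_or, not_exists, not_and] at hys
      exact ⟨y, hy, fun x hx => ⟨fun h => hys.1.1 (h ▸ hx), hys.1.2 x hx, hys.2 x hx⟩⟩)
  have hinj : Function.Injective f := fun m n h => by
    rcases lt_trichotomy m n with hmn | hmn | hmn
    · exact absurd h (hf m n hmn).1
    · exact hmn
    · exact absurd h.symm (hf n m hmn).1
  refine ⟨Set.range f, by rintro _ ⟨n, rfl⟩; exact hfA n, Set.infinite_range_of_injective hinj, ?_⟩
  rw [Set.disjoint_left]
  rintro _ ⟨n, rfl⟩ ⟨_, ⟨⟨m, rfl⟩, hs⟩, h⟩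
  rcases lt_trichotomy m n with hmn | rfl | hmn
  · exact (hf m n hmn).2.1 h
  · exact Set.disjoint_left.1 hfix (hfA m) ⟨hs, h⟩
  · exact (hf n m hmn).2.2 (by rw [← h, p.left_inv hs])

/-- The automorphism `Φ` intertwines the actions of `p` and `q` on `𝒫(ℕ)/Fin`. -/
structure Intertwines (Φ : PFin ≃o PFin) (p q : PartialEquiv ℕ ℕ) : Prop where
  image : ∀ A B, Φ (PFin.mk A) = PFin.mk B → Φ (PFin.mk (pimage p A)) = PFin.mk (pimage q B)
  image_symm : ∀ A B, Φ (PFin.mk A) = PFin.mk B →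
    Φ (PFin.mk (pimage p.symm A)) = PFin.mk (pimage q.symm B)

namespace Intertwines

variable {Φ : PFin ≃o PFin} {p q p' q' : PartialEquiv ℕ ℕ}

theorem symm (h : Intertwines Φ p q) : Intertwines Φ p.symm q.symm :=
  ⟨h.image_symm, h.image⟩

theorem inverse (h : Intertwines Φ p q) : Intertwines Φ.symm q p :=
  ⟨fun A B hAB => (OrderIso.symm_apply_eq Φ).2
      (h.image B A ((OrderIso.symm_apply_eq Φ).1 hAB).symm).symm,
    fun A B hAB => (OrderIso.symm_apply_eq Φ).2
      (h.image_symm B A ((OrderIso.symm_apply_eq Φ).1 hAB).symm).symm⟩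

theorem trans (h : Intertwines Φ p q) (h' : Intertwines Φ p' q') :
    Intertwines Φ (p.trans p') (q.trans q') :=
  ⟨fun A B hAB => by
      rw [pimage_trans, pimage_trans]; exact h'.image _ _ (h.image _ _ hAB),
    fun A B hAB => by
      rw [PartialEquiv.trans_symm_eq_symm_trans_symm, PartialEquiv.trans_symm_eq_symm_trans_symm,
        pimage_trans, pimage_trans]
      exact h.image_symm _ _ (h'.image_symm _ _ hAB)⟩

theorem ofSet {A B : Set ℕ} (h : Φ (PFin.mk A) = PFin.mk B) :
    Intertwines Φ (PartialEquiv.ofSet A) (PartialEquiv.ofSet B) := by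
  have key : ∀ C D, Φ (PFin.mk C) = PFin.mk D →
      Φ (PFin.mk (pimage (PartialEquiv.ofSet A) C)) =
        PFin.mk (pimage (PartialEquiv.ofSet B) D) := fun C D hCD => by
    rw [pimage_ofSet, pimage_ofSet]
    change Φ (PFin.mk C ⊓ PFin.mk A) = PFin.mk D ⊓ PFin.mk B
    rw [map_inf, hCD, h]
  exact ⟨key, key⟩

/-- Being fixed by p is visible in the quotient: every subset of `fix p` is sent to itself, whereas
an infinite set without fixed points has an infinite subset D disjoint from its image. If Φ[fix p]
were not below [fix q], such a D for q would exist inside a representative of Φ[fix p]. Its preimage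
class lies below [fix p] and is fixed by p, so [D] is fixed by q, and D would be finite. -/
theorem mk_fix_le (h : Intertwines Φ p q) : Φ (PFin.mk (fix p)) ≤ PFin.mk (fix q) := by
  obtain ⟨B, hB⟩ : ∃ B, PFin.mk B = Φ (PFin.mk (fix p)) :=
    PFin.ind (p := fun x => ∃ B, PFin.mk B = x) (fun B => ⟨B, rfl⟩) _
  rw [← hB, PFin.mk_le_mk]
  by_contra hinf
  obtain ⟨D, hD, hDinf, hdisj⟩ := exists_infinite_disjoint_pimage q hinf Set.disjoint_sdiff_left
  obtain ⟨C, hC⟩ : ∃ C, PFin.mk C = Φ.symm (PFin.mk D) :=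
    PFin.ind (p := fun x => ∃ B, PFin.mk B = x) (fun B => ⟨B, rfl⟩) _
  have hC' : Φ (PFin.mk C) = PFin.mk D := by rw [hC, OrderIso.apply_symm_apply]
  have hCfix : (C \ fix p).Finite := by
    rw [← PFin.mk_le_mk, ← Φ.le_iff_le, hC', ← hB, PFin.mk_le_mk]
    exact Set.finite_empty.subset fun x hx => hx.2 (hD hx.1).1
  have e1 : PFin.mk C = PFin.mk (C ∩ fix p) := PFin.mk_eq_mk.2 (hCfix.subset (by
    rintro x (⟨h1, h2⟩ | ⟨h1, h2⟩)
    · exact ⟨h1, fun h3 => h2 ⟨h1, h3⟩⟩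
    · exact absurd h1.1 h2))
  have e2 : pimage p (C ∩ fix p) = C ∩ fix p := by
    ext y
    constructor
    · rintro ⟨x, ⟨⟨hx, hf⟩, hs⟩, rfl⟩
      rw [hf.2]
      exact ⟨hx, hf⟩
    · rintro ⟨hx, hf⟩
      exact ⟨y, ⟨⟨hx, hf⟩, hf.1⟩, hf.2⟩
  have e3 : PFin.mk (pimage q D) = PFin.mk D := by
    rw [← h.image (C ∩ fix p) D (by rw [← e1, hC']), e2, ← e1, hC']
  refine hDinf ((PFin.mk_eq_mk.1 e3).subset fun x hx => Or.inr ⟨hx, ?_⟩)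
  exact Set.disjoint_left.1 hdisj hx

theorem mk_fix (h : Intertwines Φ p q) : Φ (PFin.mk (fix p)) = PFin.mk (fix q) :=
  le_antisymm h.mk_fix_le ((OrderIso.symm_apply_le Φ).1 h.inverse.mk_fix_le)

end Intertwines

/-! ### Corresponding partial bijections and transfer of Boolean combinations. -/

/-- Pairs of corresponding partial bijections: those generated, under composition and inversion,
by `(γ, γ')` and the identity maps of corresponding sets. -/
inductive Corr (γ γ' : AlmostPerm) (Φ : PFin ≃o PFin) : PartialEquiv ℕ ℕ → PartialEquiv ℕ ℕ → Prop
  | base : Corr γ γ' Φ γ.toPartialEquiv γ'.toPartialEquiv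
  | ofSet {A B : Set ℕ} (h : Φ (PFin.mk A) = PFin.mk B) :
      Corr γ γ' Φ (PartialEquiv.ofSet A) (PartialEquiv.ofSet B)
  | symm {p q : PartialEquiv ℕ ℕ} (h : Corr γ γ' Φ p q) : Corr γ γ' Φ p.symm q.symm
  | trans {p q p' q' : PartialEquiv ℕ ℕ} (h : Corr γ γ' Φ p q) (h' : Corr γ γ' Φ p' q') :
      Corr γ γ' Φ (p.trans p') (q.trans q')

variable {γ γ' : AlmostPerm} {Φ : PFin ≃o PFin} {p q : PartialEquiv ℕ ℕ} {S T : H →L[ℂ] H}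

theorem Corr.inverse (h : Corr γ γ' Φ p q) : Corr γ' γ Φ.symm q p := by
  induction h with
  | base => exact .base
  | ofSet h => exact .ofSet (by rw [← h, OrderIso.symm_apply_apply])
  | symm _ ih => exact ih.symm
  | trans _ _ ih ih' => exact ih.trans ih'

theorem intertwines_of_conj (hΦ : ∀ x, Φ (γ.aut x) = γ'.aut (Φ x)) :
    Intertwines Φ γ.toPartialEquiv γ'.toPartialEquiv := by
  refine ⟨fun A B h => ?_, fun A B h => ?_⟩
  · change Φ (γ.aut (PFin.mk A)) = γ'.aut (PFin.mk B)
    rw [hΦ, h]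
  · change Φ (γ.aut.symm (PFin.mk A)) = γ'.aut.symm (PFin.mk B)
    rw [← h, eq_comm, OrderIso.symm_apply_eq, ← hΦ, OrderIso.apply_symm_apply]

theorem Corr.intertwines (hΦ : ∀ x, Φ (γ.aut x) = γ'.aut (Φ x)) (h : Corr γ γ' Φ p q) :
    Intertwines Φ p q := by
  induction h with
  | base => exact intertwines_of_conj hΦ
  | ofSet h => exact .ofSet h
  | symm _ ih => exact ih.symm
  | trans _ _ ih ih' => exact ih.trans ih'

theorem Corr.refl (γ γ' : AlmostPerm) (Φ : PFin ≃o PFin) :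
    Corr γ γ' Φ (PartialEquiv.refl ℕ) (PartialEquiv.refl ℕ) := by
  have h : Φ (PFin.mk Set.univ) = PFin.mk Set.univ := map_top Φ
  exact Corr.ofSet (γ := γ) (γ' := γ') h

/-- The Boolean combinations `⋂_{i ∈ J} A i ∩ ⋂_{i ∈ s \ J} (A i)ᶜ` are preserved by `Φ`. -/
theorem map_mk_atom {ι : Type*} (s : Finset ι) (J : Set ι) (A B : ι → Set ℕ)
    (h : ∀ i ∈ s, Φ (PFin.mk (A i)) = PFin.mk (B i)) :
    Φ (PFin.mk {x | ∀ i ∈ s, x ∈ A i ↔ i ∈ J}) = PFin.mk {x | ∀ i ∈ s, x ∈ B i ↔ i ∈ J} := by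
  classical
  induction s using Finset.induction_on with
  | empty =>
    have h : Φ (PFin.mk Set.univ) = PFin.mk Set.univ := map_top Φ
    simpa using h
  | insert i s _ ih =>
    have ih' := ih fun j hj => h j (Finset.mem_insert_of_mem hj)
    have hi := h i (Finset.mem_insert_self i s)
    have split : ∀ A : ι → Set ℕ, {x | ∀ j ∈ insert i s, x ∈ A j ↔ j ∈ J} =
        (if i ∈ J then A i else (A i)ᶜ) ∩ {x | ∀ j ∈ s, x ∈ A j ↔ j ∈ J} := fun A => by
      ext x
      by_cases hJ : i ∈ J <;> simp [hJ]
    rw [split, split]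
    change Φ (PFin.mk _ ⊓ PFin.mk _) = PFin.mk _ ⊓ PFin.mk _
    rw [map_inf, ih']
    congr 1
    by_cases hJ : i ∈ J
    · simpa [hJ] using hi
    · simp only [hJ, if_false]
      change Φ (PFin.mk (A i))ᶜ = (PFin.mk (B i))ᶜ
      rw [← hi, map_compl']

/-- If a combination of indicators of the `A i` is small up to finitely many points, then so is the
same combination of indicators of corresponding sets. -/
theorem finite_lt_norm_sum_indicator {ι : Type*} (s : Finset ι) (c : ι → ℂ) (A B : ι → Set ℕ)
    (h : ∀ i ∈ s, Φ (PFin.mk (A i)) = PFin.mk (B i)) (r : ℝ)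
    (hr : {x | r < ‖∑ i ∈ s, (A i).indicator (fun _ => c i) x‖}.Finite) :
    {x | r < ‖∑ i ∈ s, (B i).indicator (fun _ => c i) x‖}.Finite := by
  classical
  have hsum : ∀ (A : ι → Set ℕ) (J : Finset ι) (x : ℕ), (∀ i ∈ s, x ∈ A i ↔ i ∈ J) →
      ∑ i ∈ s, (A i).indicator (fun _ => c i) x = ∑ i ∈ s, if i ∈ J then c i else 0 :=
    fun A J x hx => Finset.sum_congr rfl fun i hi => by
      by_cases hJ : i ∈ J
      · rw [if_pos hJ, Set.indicator_of_mem ((hx i hi).2 hJ)]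
      · rw [if_neg hJ, Set.indicator_of_notMem fun h => hJ ((hx i hi).1 h)]
  -- Split ℕ into the finitely many atoms given by the set J of indices i with x in B i. The sum
  -- depends only on J. If it exceeds r there, the atom of the A i is finite, and hence so is the
  -- atom of the B i.
  refine (s.powerset.finite_toSet.biUnion (t := fun J : Finset ι =>
    {x | (∀ i ∈ s, x ∈ B i ↔ i ∈ J) ∧ r < ‖∑ i ∈ s, if i ∈ J then c i else 0‖}) ?_).subset ?_
  · intro J _
    by_cases hJ : r < ‖∑ i ∈ s, if i ∈ J then c i else 0‖
    · simp only [hJ, and_true]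
      have e := map_mk_atom (Φ := Φ) s (↑J) A B h
      have : PFin.mk {x | ∀ i ∈ s, x ∈ A i ↔ i ∈ (J : Set ι)} = PFin.mk ∅ := by
        rw [PFin.mk_eq_mk]
        refine hr.subset ?_
        rintro x (⟨hx, -⟩ | ⟨hx, -⟩)
        · change r < _
          rw [hsum A J x hx]
          exact hJ
        · exact hx.elim
      rw [this] at e
      have e' : PFin.mk ∅ = PFin.mk {x | ∀ i ∈ s, x ∈ B i ↔ i ∈ (J : Set ι)} := by
        rw [← e]; exact (map_bot Φ).symm
      exact (PFin.mk_eq_mk.1 e').subset fun x hx => Or.inr ⟨hx, id⟩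
    · exact Set.finite_empty.subset fun x hx => hJ hx.2
  · intro x hx
    have hJ : ∀ i ∈ s, x ∈ B i ↔ i ∈ s.filter (fun i => x ∈ B i) := fun i hi => by simp [hi]
    refine Set.mem_biUnion (x := s.filter fun i => x ∈ B i)
      (Finset.mem_coe.2 (Finset.mem_powerset.2 (Finset.filter_subset _ _))) ⟨hJ, ?_⟩
    rw [← hsum B _ x hJ]
    exact hx

/-! ### Weighted partial shifts -/

open Classical in
theorem sum_weighted_le {a : ℕ → ℂ} {C : ℝ} (ha : ∀ j, ‖a j‖ ≤ C) (p : PartialEquiv ℕ ℕ) (x : H)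
    (s : Finset ℕ) :
    ∑ j ∈ s, ‖(if j ∈ p.target then a j * x (p.symm j) else 0 : ℂ)‖ ^ (2 : ENNReal).toReal ≤
      (C * ‖x‖) ^ (2 : ENNReal).toReal := by
  have hC : 0 ≤ C := (norm_nonneg _).trans (ha 0)
  have hinj : Set.InjOn p.symm ↑(s.filter (· ∈ p.target)) := by
    intro i hi j hj h
    exact p.symm.injOn (Finset.mem_filter.1 hi).2 (Finset.mem_filter.1 hj).2 h
  calc ∑ j ∈ s, ‖(if j ∈ p.target then a j * x (p.symm j) else 0 : ℂ)‖ ^ (2 : ENNReal).toReal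
      = ∑ j ∈ s.filter (· ∈ p.target), ‖a j * x (p.symm j)‖ ^ (2 : ENNReal).toReal := by
        rw [Finset.sum_filter]
        refine Finset.sum_congr rfl fun j _ => ?_
        by_cases hj : j ∈ p.target <;> simp [hj]
    _ ≤ ∑ j ∈ s.filter (· ∈ p.target),
          C ^ (2 : ENNReal).toReal * ‖x (p.symm j)‖ ^ (2 : ENNReal).toReal := by
        refine Finset.sum_le_sum fun j _ => ?_
        rw [norm_mul, ← Real.mul_rpow hC (norm_nonneg _)]
        gcongr
        exact ha j
    _ = C ^ (2 : ENNReal).toReal * ∑ i ∈ (s.filter (· ∈ p.target)).image p.symm,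
          ‖x i‖ ^ (2 : ENNReal).toReal := by
        rw [Finset.sum_image hinj, Finset.mul_sum]
    _ ≤ (C * ‖x‖) ^ (2 : ENNReal).toReal := by
        rw [Real.mul_rpow hC (norm_nonneg _)]
        gcongr
        exact lp.sum_rpow_le_norm_rpow (by simp) x _

open Classical in
theorem exists_weighted {a : ℕ → ℂ} {C : ℝ} (ha : ∀ j, ‖a j‖ ≤ C) (p : PartialEquiv ℕ ℕ) :
    ∃ T : H →L[ℂ] H, (∀ u j, T u j = if j ∈ p.target then a j * u (p.symm j) else 0) ∧
      ‖T‖ ≤ C := by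
  have hC : 0 ≤ C := (norm_nonneg _).trans (ha 0)
  refine ⟨LinearMap.mkContinuous
    { toFun := fun x => ⟨fun j => if j ∈ p.target then a j * x (p.symm j) else 0,
        memℓp_gen' (sum_weighted_le ha p x)⟩
      map_add' := fun x y => by
        ext j
        simp only [lp.coeFn_add, Pi.add_apply]
        split_ifs
        · exact mul_add _ _ _
        · exact (add_zero _).symm
      map_smul' := fun c x => by
        ext j
        simp only [lp.coeFn_smul, Pi.smul_apply, RingHom.id_apply, smul_eq_mul]
        split_ifs
        · ring
        · exact (mul_zero _).symm } C (fun x =>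
      lp.norm_le_of_forall_sum_le (by simp) (by positivity) (sum_weighted_le ha p x)),
    fun u j => rfl, LinearMap.mkContinuous_norm_le _ hC _⟩

open Classical in
/-- The operator with coordinates `u ↦ (a j * u (p⁻¹ j))_{j ∈ ran p}`; zero if `a` is unbounded. -/
def weighted (a : ℕ → ℂ) (p : PartialEquiv ℕ ℕ) : H →L[ℂ] H :=
  if h : ∃ C, ∀ j, ‖a j‖ ≤ C then (exists_weighted h.choose_spec p).choose else 0

open Classical in
theorem weighted_apply {a : ℕ → ℂ} {C : ℝ} (ha : ∀ j, ‖a j‖ ≤ C) (p : PartialEquiv ℕ ℕ) (u : H)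
    (j : ℕ) : weighted a p u j = if j ∈ p.target then a j * u (p.symm j) else 0 := by
  have h : ∃ C, ∀ j, ‖a j‖ ≤ C := ⟨C, ha⟩
  rw [weighted, dif_pos h]
  exact (exists_weighted h.choose_spec p).choose_spec.1 u j

theorem norm_weighted_le {a : ℕ → ℂ} {C : ℝ} (ha : ∀ j, ‖a j‖ ≤ C) (p : PartialEquiv ℕ ℕ) :
    ‖weighted a p‖ ≤ C := by
  obtain ⟨T, hT, hC⟩ := exists_weighted ha p
  rwa [show weighted a p = T by ext u j; rw [weighted_apply ha, hT]]

/-- The partial isometry `δ_i ↦ δ_{p i}` for `i ∈ dom p`. -/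
def V (p : PartialEquiv ℕ ℕ) : H →L[ℂ] H := weighted (fun _ => 1) p

/-- The diagonal operator with bounded entries `a`. -/
def diagOp (a : ℕ → ℂ) : H →L[ℂ] H := weighted a (PartialEquiv.refl ℕ)

open Classical in
theorem V_apply (p : PartialEquiv ℕ ℕ) (u : H) (j : ℕ) :
    V p u j = if j ∈ p.target then u (p.symm j) else 0 := by
  rw [V, weighted_apply (C := 1) (by simp)]
  simp

theorem diagOp_apply {a : ℕ → ℂ} {C : ℝ} (ha : ∀ j, ‖a j‖ ≤ C) (u : H) (j : ℕ) :
    diagOp a u j = a j * u j := by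
  rw [diagOp, weighted_apply ha]
  simp

theorem norm_diagOp_le {a : ℕ → ℂ} {C : ℝ} (ha : ∀ j, ‖a j‖ ≤ C) : ‖diagOp a‖ ≤ C :=
  norm_weighted_le ha _

theorem V_eq_v (γ : AlmostPerm) : V γ.toPartialEquiv = v γ := by
  ext u j
  rw [V_apply, v_apply, shiftFun]

theorem V_mul_V (p q : PartialEquiv ℕ ℕ) : V p * V q = V (q.trans p) := by
  classical
  ext u j
  rw [mul_apply_eq_comp, V_apply, V_apply, V_apply]
  simp only [PartialEquiv.trans_target, Set.mem_inter_iff, Set.mem_preimage,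
    PartialEquiv.trans_symm_eq_symm_trans_symm, PartialEquiv.coe_trans, Function.comp_apply]
  split_ifs <;> tauto

theorem diagOp_mul_V {a : ℕ → ℂ} {C : ℝ} (ha : ∀ j, ‖a j‖ ≤ C) (p : PartialEquiv ℕ ℕ) :
    diagOp a * V p = weighted a p := by
  classical
  ext u j
  rw [mul_apply_eq_comp, diagOp_apply ha, V_apply, weighted_apply ha]
  split_ifs <;> simp

/-! ### Matrix entries -/

theorem hasSum_δ (u : H) : HasSum (fun i => u i • δ i) u := by
  have h := lp.hasSum_single (p := 2) (by simp) u
  convert! h using 2 with i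
  ext j
  simp [δ, lp.single_apply, Pi.single_apply]

theorem norm_δ (i : ℕ) : ‖δ i‖ = 1 := by simp [δ, lp.norm_single]

theorem norm_apply_le (u : H) (i : ℕ) : ‖u i‖ ≤ ‖u‖ := lp.norm_apply_le_norm (by simp) u i

theorem norm_entry_le (T : H →L[ℂ] H) (i j : ℕ) : ‖T (δ i) j‖ ≤ ‖T‖ :=
  (norm_apply_le _ _).trans ((T.le_opNorm _).trans (by rw [norm_δ, mul_one]))

theorem ext_entry {S T : H →L[ℂ] H} (h : ∀ i j, S (δ i) j = T (δ i) j) : S = T := by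
  ext1 u
  have hS := (hasSum_δ u).mapL S
  have hT := (hasSum_δ u).mapL T
  refine hS.unique ?_
  convert! hT using 2 with i
  rw [map_smul, map_smul]
  congr 1
  ext j
  exact h i j

theorem star_entry (T : H →L[ℂ] H) (i j : ℕ) :
    (star T : H →L[ℂ] H) (δ i) j = conj (T (δ j) i) := by
  rw [← inner_δ_left, ContinuousLinearMap.star_eq_adjoint, ContinuousLinearMap.adjoint_inner_right,
    inner_δ_right]

open Classical in
theorem V_entry (p : PartialEquiv ℕ ℕ) (i j : ℕ) :
    V p (δ i) j = if i ∈ p.source ∧ p i = j then 1 else 0 := by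
  rw [V_apply, δ_apply]
  by_cases hj : j ∈ p.target
  · rw [if_pos hj]
    refine if_congr ⟨?_, ?_⟩ rfl rfl
    · rintro rfl
      exact ⟨p.map_target hj, p.right_inv hj⟩
    · rintro ⟨hi, rfl⟩
      exact p.left_inv hi
  · rw [if_neg hj, if_neg]
    rintro ⟨hi, rfl⟩
    exact hj (p.map_source hi)

theorem V_δ_of_mem {p : PartialEquiv ℕ ℕ} {i : ℕ} (hi : i ∈ p.source) : V p (δ i) = δ (p i) := by
  classical
  ext j
  rw [V_entry, δ_apply]
  simp [hi, eq_comm]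

theorem star_V (p : PartialEquiv ℕ ℕ) : star (V p) = V p.symm := by
  classical
  refine ext_entry fun i j => ?_
  rw [star_entry, V_entry, V_entry, apply_ite conj, map_one, map_zero]
  refine if_congr ⟨?_, ?_⟩ rfl rfl
  · rintro ⟨hj, rfl⟩
    exact ⟨p.map_source hj, p.left_inv hj⟩
  · rintro ⟨hi, rfl⟩
    exact ⟨p.map_target hi, p.right_inv hi⟩

/-! ### Diagonal operators -/

/-- The projection to the coordinates in `A`. -/
def proj (A : Set ℕ) : H →L[ℂ] H := diagOp (A.indicator 1)

theorem norm_indicator_one_le (A : Set ℕ) (j : ℕ) : ‖A.indicator (1 : ℕ → ℂ) j‖ ≤ 1 := by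
  by_cases h : j ∈ A <;> simp [h]

theorem proj_apply (A : Set ℕ) (u : H) (j : ℕ) : proj A u j = A.indicator u j := by
  rw [proj, diagOp_apply (norm_indicator_one_le A)]
  by_cases h : j ∈ A <;> simp [h]

theorem norm_proj_le (A : Set ℕ) : ‖proj A‖ ≤ 1 := norm_diagOp_le (norm_indicator_one_le A)

theorem proj_eq_V (A : Set ℕ) : proj A = V (PartialEquiv.ofSet A) := by
  classical
  ext u j
  rw [proj_apply, V_apply]
  by_cases h : j ∈ A <;> simp [h]

theorem diagOp_mul_diagOp {a b : ℕ → ℂ} {C D : ℝ} (ha : ∀ j, ‖a j‖ ≤ C) (hb : ∀ j, ‖b j‖ ≤ D) :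
    diagOp a * diagOp b = diagOp (fun j => a j * b j) := by
  have hab : ∀ j, ‖a j * b j‖ ≤ C * D := fun j => by
    rw [norm_mul]
    exact mul_le_mul (ha j) (hb j) (norm_nonneg _) ((norm_nonneg _).trans (ha 0))
  ext u j
  rw [mul_apply_eq_comp, diagOp_apply ha, diagOp_apply hb, diagOp_apply hab, mul_assoc]

theorem star_diagOp {a : ℕ → ℂ} {C : ℝ} (ha : ∀ j, ‖a j‖ ≤ C) :
    star (diagOp a) = diagOp (fun j => conj (a j)) := by
  refine ext_entry fun i j => ?_
  rw [star_entry, diagOp_apply ha, diagOp_apply (C := C) (by simpa using ha), δ_apply, δ_apply,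
    map_mul]
  by_cases h : i = j
  · subst h; simp
  · simp [h, Ne.symm h]

theorem norm_sq_eq_tsum (u : H) : HasSum (fun i => ‖u i‖ ^ 2) (‖u‖ ^ 2) := by
  have h := lp.hasSum_norm (p := 2) (by simp) u
  simpa using h

theorem proj_finset_apply (s : Finset ℕ) (u : H) : proj s u = ∑ i ∈ s, u i • δ i := by
  classical
  ext j
  rw [proj_apply, lp.coeFn_sum, Finset.sum_apply]
  simp [δ_apply, Set.indicator_apply]

theorem tendsto_proj (u : H) :
    Filter.Tendsto (fun s : Finset ℕ => proj s u) Filter.atTop (nhds u) := by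
  simp only [proj_finset_apply]
  exact hasSum_δ u

/-- The finite corners converge strongly to T, and a norm bound survives strong limits. -/
theorem norm_le_of_forall_proj {T : H →L[ℂ] H} {C : ℝ} (hC : 0 ≤ C)
    (h : ∀ s : Finset ℕ, ‖proj s * T * proj s‖ ≤ C) : ‖T‖ ≤ C := by
  refine T.opNorm_le_bound hC fun u => ?_
  have h1 : Filter.Tendsto (fun s : Finset ℕ => proj s (T (proj s u))) Filter.atTop
      (nhds (T u)) := by
    have h2 := tendsto_proj (T u)
    have h3 : Filter.Tendsto (fun s : Finset ℕ => proj s (T (proj s u - u))) Filter.atTop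
        (nhds 0) := by
      have h4 : Filter.Tendsto (fun s : Finset ℕ => ‖T (proj s u - u)‖) Filter.atTop (nhds 0) := by
        have := (T.continuous.tendsto _).comp ((tendsto_proj u).sub_const u)
        simpa using this.norm
      refine squeeze_zero_norm (fun s => ?_) h4
      exact ((proj s).le_opNorm _).trans
        (mul_le_of_le_one_left (norm_nonneg _) (norm_proj_le _))
    simpa using h3.add h2
  refine le_of_tendsto h1.norm (Filter.Eventually.of_forall fun s => ?_)
  exact ((proj s * T * proj s).le_opNorm u).trans (by gcongr; exact h s)

/-- Bounded diagonal operators are approximated by combinations of projections. -/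
theorem diagOp_mem_closure_span {a : ℕ → ℂ} {C : ℝ} (ha : ∀ j, ‖a j‖ ≤ C) :
    diagOp a ∈ closure (Submodule.span ℂ (Set.range proj) : Set (H →L[ℂ] H)) := by
  classical
  rw [Metric.mem_closure_iff]
  intro ε hε
  have htb : TotallyBounded (Set.range a) :=
    (isCompact_closedBall (0 : ℂ) C).totallyBounded.subset (by
      rintro _ ⟨j, rfl⟩
      simpa using ha j)
  -- Rounding the entries to a finite ε/2-net leaves a sequence with finitely many values, that is,
  -- a finite combination of projections.
  obtain ⟨t, htf, ht⟩ := Metric.totallyBounded_iff.1 htb (ε / 2) (half_pos hε)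
  have hch : ∀ j, ∃ z ∈ t, ‖a j - z‖ < ε / 2 := fun j => by
    obtain ⟨z, hz, hd⟩ := Set.mem_iUnion₂.1 (ht ⟨j, rfl⟩)
    exact ⟨z, hz, by simpa [dist_eq_norm] using hd⟩
  choose f hft hf using hch
  have hsum : ∀ (u : H) (j : ℕ),
      (∑ z ∈ htf.toFinset, z • proj (f ⁻¹' {z})) u j = f j * u j := by
    intro u j
    rw [sum_apply, lp.coeFn_sum, Finset.sum_apply,
      Finset.sum_eq_single (f j)]
    · simp [proj_apply]
    · intro z _ hz
      simp [proj_apply, Ne.symm hz]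
    · intro h
      exact absurd (htf.mem_toFinset.2 (hft j)) h
  refine ⟨∑ z ∈ htf.toFinset, z • proj (f ⁻¹' {z}),
    Submodule.sum_mem _ fun z _ => Submodule.smul_mem _ _ (Submodule.subset_span ⟨_, rfl⟩), ?_⟩
  have hb : ∀ j, ‖a j - f j‖ ≤ ε / 2 := fun j => (hf j).le
  have : diagOp a - ∑ z ∈ htf.toFinset, z • proj (f ⁻¹' {z}) = diagOp (fun j => a j - f j) := by
    ext u j
    rw [diagOp_apply hb, sub_apply, lp.coeFn_sub, Pi.sub_apply, hsum,
      diagOp_apply ha, sub_mul]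
  rw [dist_eq_norm, this]
  exact (norm_diagOp_le hb).trans_lt (half_lt_self hε)

/-! ### The algebra of corresponding pairs of operators -/

/-- The linear span of the pairs `(V p, V q)` for corresponding `p` and `q`. -/
def corrSpan (γ γ' : AlmostPerm) (Φ : PFin ≃o PFin) :
    Submodule ℂ ((H →L[ℂ] H) × (H →L[ℂ] H)) :=
  Submodule.span ℂ {x | ∃ p q, Corr γ γ' Φ p q ∧ x = (V p, V q)}

/-- The pairs in `corrSpan` form a `*`-algebra. -/
def corrAlg (γ γ' : AlmostPerm) (Φ : PFin ≃o PFin) :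
    StarSubalgebra ℂ ((H →L[ℂ] H) × (H →L[ℂ] H)) where
  toSubalgebra := (corrSpan γ γ' Φ).toSubalgebra
    (Submodule.subset_span ⟨_, _, Corr.refl γ γ' Φ, by
      have h : V (PartialEquiv.refl ℕ) = 1 := by
        classical
        ext u j
        rw [V_apply]
        simp
      rw [h]; rfl⟩)
    (by
      intro x y hx hy
      have h := Submodule.mul_mem_mul hx hy
      rw [corrSpan, Submodule.span_mul_span] at h
      refine Submodule.span_mono ?_ h
      rintro _ ⟨_, ⟨p, q, hpq, rfl⟩, _, ⟨p', q', hpq', rfl⟩, rfl⟩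
      exact ⟨_, _, hpq'.trans hpq, by simp only [Prod.mk_mul_mk, V_mul_V]⟩)
  star_mem' := by
    intro x hx
    change star x ∈ corrSpan γ γ' Φ
    change x ∈ corrSpan γ γ' Φ at hx
    induction hx using Submodule.span_induction with
    | mem x hx =>
      obtain ⟨p, q, h, rfl⟩ := hx
      refine Submodule.subset_span ⟨_, _, h.symm, ?_⟩
      rw [Prod.star_def, star_V, star_V]
    | zero => rw [star_zero]; exact Submodule.zero_mem _
    | add x y _ _ hx hy => rw [star_add]; exact Submodule.add_mem _ hx hy
    | smul c x _ hx => rw [star_smul]; exact Submodule.smul_mem _ _ hx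

/-- The C*-algebra of corresponding pairs of operators. -/
def corrCStar (γ γ' : AlmostPerm) (Φ : PFin ≃o PFin) :
    StarSubalgebra ℂ ((H →L[ℂ] H) × (H →L[ℂ] H)) :=
  (corrAlg γ γ' Φ).topologicalClosure

instance isClosed_corrCStar (γ γ' : AlmostPerm) (Φ : PFin ≃o PFin) :
    IsClosed (corrCStar γ γ' Φ : Set ((H →L[ℂ] H) × (H →L[ℂ] H))) :=
  StarSubalgebra.isClosed_topologicalClosure _

theorem mem_corrCStar_iff {x : (H →L[ℂ] H) × (H →L[ℂ] H)} :
    x ∈ corrCStar γ γ' Φ ↔ x ∈ closure (corrSpan γ γ' Φ : Set _) := Iff.rfl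

theorem Corr.mem_corrCStar (h : Corr γ γ' Φ p q) : (V p, V q) ∈ corrCStar γ γ' Φ :=
  (corrAlg γ γ' Φ).le_topologicalClosure (Submodule.subset_span ⟨p, q, h, rfl⟩)

/-- The construction is symmetric in γ and γ', so results on first coordinates also serve for second
ones. -/
theorem swap_mem_corrCStar (h : (S, T) ∈ corrCStar γ γ' Φ) :
    (T, S) ∈ corrCStar γ' γ Φ.symm := by
  rw [mem_corrCStar_iff] at h ⊢
  have hc : Continuous (Prod.swap : (H →L[ℂ] H) × (H →L[ℂ] H) → _) := continuous_swap
  refine map_mem_closure (f := Prod.swap) hc h fun x hx => ?_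
  rw [SetLike.mem_coe] at hx ⊢
  induction hx using Submodule.span_induction with
  | mem x hx =>
    obtain ⟨p, q, h, rfl⟩ := hx
    exact Submodule.subset_span ⟨q, p, h.inverse, rfl⟩
  | zero => exact Submodule.zero_mem _
  | add x y _ _ hx hy => exact Submodule.add_mem _ hx hy
  | smul c x _ hx => exact Submodule.smul_mem _ _ hx

theorem hasPropagation_proj (γ : AlmostPerm) (A : Set ℕ) : HasPropagation γ 0 (proj A) := by
  intro i j hij
  have hne : j ≠ i := by
    rintro rfl
    simp [AlmostPerm.dist] at hij
  classical
  rw [inner_δ_right, proj_apply, Set.indicator_apply, δ_apply, if_neg hne]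
  simp

theorem Corr.V_mem_uniformRoe (h : Corr γ γ' Φ p q) : V p ∈ uniformRoe γ := by
  induction h with
  | base => rw [V_eq_v]; exact v_mem_uniformRoe γ
  | ofSet h =>
    rw [← proj_eq_V]
    exact (algUniformRoe γ).le_topologicalClosure ⟨0, hasPropagation_proj γ _⟩
  | symm _ ih => rw [← star_V]; exact star_mem ih
  | trans _ _ ih ih' => rw [← V_mul_V]; exact mul_mem ih' ih

theorem fst_mem_uniformRoe (h : (S, T) ∈ corrCStar γ γ' Φ) : S ∈ uniformRoe γ := by
  have hcl : IsClosed (uniformRoe γ : Set (H →L[ℂ] H)) :=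
    StarSubalgebra.isClosed_topologicalClosure _
  rw [mem_corrCStar_iff] at h
  have := map_mem_closure (f := Prod.fst) (t := (uniformRoe γ : Set (H →L[ℂ] H)))
    continuous_fst h fun x hx => ?_
  · rwa [hcl.closure_eq] at this
  · rw [SetLike.mem_coe] at hx ⊢
    induction hx using Submodule.span_induction with
    | mem x hx =>
      obtain ⟨p, q, h, rfl⟩ := hx
      exact h.V_mem_uniformRoe
    | zero => exact zero_mem _
    | add x y _ _ hx hy => exact add_mem hx hy
    | smul c x _ hx => exact SMulMemClass.smul_mem _ hx

theorem snd_mem_uniformRoe (h : (S, T) ∈ corrCStar γ γ' Φ) : T ∈ uniformRoe γ' :=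
  fst_mem_uniformRoe (swap_mem_corrCStar h)

/-! ### Every element of the uniform Roe algebra has a corresponding element -/

/-- The compositions of at most `m` factors `γ` or `γ⁻¹`. -/
def words (γ : AlmostPerm) : ℕ → List (PartialEquiv ℕ ℕ)
  | 0 => [PartialEquiv.refl ℕ]
  | m + 1 => words γ m ++ (words γ m).map γ.toPartialEquiv.trans ++
      (words γ m).map γ.toPartialEquiv.symm.trans

theorem refl_mem_words (γ : AlmostPerm) (m : ℕ) : PartialEquiv.refl ℕ ∈ words γ m := by
  induction m with
  | zero => simp [words]
  | succ m ih => simp [words, ih]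

/-- Each edge is a step of γ or γ⁻¹. The point is that one finite list of partial bijections covers
all pairs at distance at most m. -/
theorem exists_mem_words_of_walk {i j : ℕ} (w : γ.graph.Walk i j) {m : ℕ} (hw : w.length ≤ m) :
    ∃ p ∈ words γ m, i ∈ p.source ∧ p i = j := by
  induction w generalizing m with
  | nil => exact ⟨_, refl_mem_words γ m, by simp, rfl⟩
  | cons h w ih =>
    rw [SimpleGraph.Walk.length_cons] at hw
    obtain ⟨m, rfl⟩ : ∃ k, m = k + 1 := ⟨m - 1, by omega⟩
    obtain ⟨p, hp, hs, hj⟩ := ih (m := m) (by omega)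
    rw [AlmostPerm.graph, SimpleGraph.fromRel_adj] at h
    obtain ⟨-, ⟨h1, rfl⟩ | ⟨h1, rfl⟩⟩ := h
    · exact ⟨γ.toPartialEquiv.trans p,
        List.mem_append_left _ (List.mem_append_right _ (List.mem_map_of_mem hp)), ⟨h1, hs⟩, hj⟩
    · refine ⟨γ.toPartialEquiv.symm.trans p,
        List.mem_append_right _ (List.mem_map_of_mem hp), ?_, ?_⟩
      · rw [PartialEquiv.trans_source]
        refine ⟨γ.map_source h1, ?_⟩
        rw [Set.mem_preimage, γ.left_inv h1]
        exact hs
      · rw [PartialEquiv.coe_trans, Function.comp_apply, γ.left_inv h1]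
        exact hj

theorem exists_mem_words_of_dist_le {i j m : ℕ} (h : γ.dist i j ≤ m) :
    ∃ p ∈ words γ m, i ∈ p.source ∧ p i = j := by
  obtain ⟨w, hw⟩ := SimpleGraph.exists_walk_of_edist_ne_top
    (ne_top_of_le_ne_top (ENat.natCast_ne_top m) h)
  refine exists_mem_words_of_walk w ?_
  rw [AlmostPerm.dist, ← hw] at h
  exact_mod_cast h

theorem exists_corr_of_mem_words (γ' : AlmostPerm) (Φ : PFin ≃o PFin) {m : ℕ}
    (h : p ∈ words γ m) : ∃ q, Corr γ γ' Φ p q := by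
  induction m generalizing p with
  | zero =>
    obtain rfl : p = _ := by simpa [words] using h
    exact ⟨_, .refl γ γ' Φ⟩
  | succ m ih =>
    simp only [words, List.mem_append, List.mem_map] at h
    obtain (h | ⟨p, h, rfl⟩) | ⟨p, h, rfl⟩ := h
    · exact ih h
    · obtain ⟨q, hq⟩ := ih h
      exact ⟨_, Corr.base.trans hq⟩
    · obtain ⟨q, hq⟩ := ih h
      exact ⟨_, Corr.base.symm.trans hq⟩

/-- An operator supported on finitely many graphs of partial bijections is a combination of the
corresponding partial isometries with diagonal coefficients. -/
theorem mem_of_support_subset (D : StarSubalgebra ℂ (H →L[ℂ] H))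
    (hdiag : ∀ (a : ℕ → ℂ) (C : ℝ), (∀ j, ‖a j‖ ≤ C) → diagOp a ∈ D)
    (l : List (PartialEquiv ℕ ℕ)) (hl : ∀ p ∈ l, V p ∈ D) (T : H →L[ℂ] H)
    (hT : ∀ i j, T (δ i) j ≠ 0 → ∃ p ∈ l, i ∈ p.source ∧ p i = j) : T ∈ D := by
  classical
  induction l generalizing T with
  | nil =>
    have : T = 0 := ext_entry fun i j => by
      by_contra h
      obtain ⟨p, hp, -⟩ := hT i j h
      simp at hp
    rw [this]
    exact zero_mem D
  | cons p l ih =>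
    -- These weights are the entries of T along the graph of p, so subtracting `weighted a p` clears
    -- that graph and leaves the tail of the list. Off the target of p the value is arbitrary and is
    -- killed by V p.
    let a : ℕ → ℂ := fun j => T (δ (p.symm j)) j
    have ha : ∀ j, ‖a j‖ ≤ ‖T‖ := fun j => norm_entry_le T _ _
    have hw : ∀ i j, weighted a p (δ i) j = if i ∈ p.source ∧ p i = j then T (δ i) j else 0 := by
      intro i j
      have := congrArg (fun X : H →L[ℂ] H => X (δ i) j) (diagOp_mul_V ha p)
      rw [← this, mul_apply_eq_comp, diagOp_apply ha, V_entry]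
      split_ifs with h
      · obtain ⟨hi, rfl⟩ := h
        simp only [a, p.left_inv hi, mul_one]
      · exact mul_zero _
    have h1 : weighted a p ∈ D := by
      rw [← diagOp_mul_V ha]
      exact mul_mem (hdiag a _ ha) (hl p (by simp))
    have h2 : T - weighted a p ∈ D := by
      refine ih (fun q hq => hl q (by simp [hq])) _ fun i j hij => ?_
      rw [sub_apply, lp.coeFn_sub, Pi.sub_apply, hw] at hij
      by_cases h : i ∈ p.source ∧ p i = j
      · simp [h] at hij
      · rw [if_neg h, sub_zero] at hij
        obtain ⟨q, hq, hq'⟩ := hT i j hij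
        rcases List.mem_cons.1 hq with rfl | hq
        · exact absurd hq' h
        · exact ⟨q, hq, hq'⟩
    simpa using add_mem h2 h1

/-- The set of first coordinates is a closed *-algebra. It contains every `proj A`, because any
representative of Φ[A] provides a partner, and every V p with p a word in γ; by approximation it
contains all bounded diagonal operators, hence all operators of finite propagation, and finally
their closure. -/
theorem exists_mem_corrCStar (γ' : AlmostPerm) (Φ : PFin ≃o PFin) (hS : S ∈ uniformRoe γ) :
    ∃ T, (S, T) ∈ corrCStar γ γ' Φ := by
  let f : corrCStar γ γ' Φ →⋆ₐ[ℂ] (H →L[ℂ] H) :=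
    (StarAlgHom.fst ℂ (H →L[ℂ] H) (H →L[ℂ] H)).comp (corrCStar γ γ' Φ).subtype
  have hf : ∀ {X Y}, (X, Y) ∈ corrCStar γ γ' Φ → X ∈ f.range := fun {X Y} h => ⟨⟨(X, Y), h⟩, rfl⟩
  have hcl : IsClosed (f.range : Set (H →L[ℂ] H)) := f.isClosed_range
  have hproj : ∀ A, proj A ∈ f.range := fun A => by
    obtain ⟨B, hB⟩ : ∃ B, PFin.mk B = Φ (PFin.mk A) :=
      PFin.ind (p := fun x => ∃ B, PFin.mk B = x) (fun B => ⟨B, rfl⟩) _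
    rw [proj_eq_V]
    exact hf (Corr.ofSet (γ := γ) (γ' := γ') hB.symm).mem_corrCStar
  have hdiag : ∀ (a : ℕ → ℂ) (C : ℝ), (∀ j, ‖a j‖ ≤ C) → diagOp a ∈ f.range := fun a C ha => by
    refine closure_minimal ?_ hcl (diagOp_mem_closure_span ha)
    have : Submodule.span ℂ (Set.range proj) ≤ Subalgebra.toSubmodule f.range.toSubalgebra :=
      Submodule.span_le.2 (by rintro _ ⟨A, rfl⟩; exact hproj A)
    exact this
  have hle : algUniformRoe γ ≤ f.range := by
    rintro X ⟨m, hX⟩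
    refine mem_of_support_subset _ hdiag (words γ m) (fun p hp => ?_) X fun i j hij => ?_
    · obtain ⟨q, hq⟩ := exists_corr_of_mem_words γ' Φ hp
      exact hf hq.mem_corrCStar
    · refine exists_mem_words_of_dist_le (not_lt.1 fun h => hij (hX.apply_eq_zero h))
  obtain ⟨⟨⟨X, Y⟩, hXY⟩, rfl⟩ :=
    StarSubalgebra.topologicalClosure_minimal hle hcl hS
  exact ⟨Y, hXY⟩

/-! ### Diagonal entries of corresponding operators -/

theorem V_diag_entry (p : PartialEquiv ℕ ℕ) (c : ℂ) (z : ℕ) :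
    c * V p (δ z) z = (fix p).indicator (fun _ => c) z := by
  classical
  rw [V_entry, Set.indicator_apply, mul_ite, mul_one, mul_zero]
  exact if_congr Iff.rfl rfl rfl

/-- If the diagonal entries of `S` tend to zero, then so do those of a corresponding `T`. -/
theorem tendsto_diag_of_mem_corrCStar (hΦ : ∀ x, Φ (γ.aut x) = γ'.aut (Φ x))
    (h : (S, T) ∈ corrCStar γ γ' Φ)
    (hS : Filter.Tendsto (fun z => S (δ z) z) Filter.cofinite (nhds 0)) :
    Filter.Tendsto (fun z => T (δ z) z) Filter.cofinite (nhds 0) := by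
  rw [Metric.tendsto_nhds] at hS ⊢
  intro ε hε
  rw [mem_corrCStar_iff, Metric.mem_closure_iff] at h
  obtain ⟨⟨S', T'⟩, hmem, hd⟩ := h (ε / 3) (by positivity)
  rw [Prod.dist_eq, max_lt_iff, dist_eq_norm, dist_eq_norm] at hd
  obtain ⟨n, c, g, hg⟩ := (Submodule.mem_span_set' (M := (H →L[ℂ] H) × (H →L[ℂ] H))).1 hmem
  choose p q hpq hgpq using fun i => (g i).2
  have hS' : ∀ z, S' (δ z) z = ∑ i, (fix (p i)).indicator (fun _ => c i) z := fun z => by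
    have : S' = ∑ i, c i • V (p i) := by
      rw [← show (_ : (H →L[ℂ] H) × (H →L[ℂ] H)).1 = S' from congrArg Prod.fst hg, Prod.fst_sum]
      exact Finset.sum_congr rfl fun i _ => by rw [hgpq]; rfl
    rw [this, sum_apply, lp.coeFn_sum, Finset.sum_apply]
    exact Finset.sum_congr rfl fun i _ => V_diag_entry _ _ _
  have hT' : ∀ z, T' (δ z) z = ∑ i, (fix (q i)).indicator (fun _ => c i) z := fun z => by
    have : T' = ∑ i, c i • V (q i) := by
      rw [← show (_ : (H →L[ℂ] H) × (H →L[ℂ] H)).2 = T' from congrArg Prod.snd hg, Prod.snd_sum]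
      exact Finset.sum_congr rfl fun i _ => by rw [hgpq]; rfl
    rw [this, sum_apply, lp.coeFn_sum, Finset.sum_apply]
    exact Finset.sum_congr rfl fun i _ => V_diag_entry _ _ _
  have entry : ∀ (X Y : H →L[ℂ] H) z, ‖X (δ z) z - Y (δ z) z‖ ≤ ‖X - Y‖ := fun X Y z =>
    norm_entry_le (X - Y) z z
  -- The threshold 2ε/3 is ε/3 for the diagonal of S off a finite set plus ε/3 for the approximation
  -- by S'. Passing from T' back to T uses the last ε/3.
  have key := finite_lt_norm_sum_indicator (Φ := Φ) Finset.univ c (fun i => fix (p i))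
    (fun i => fix (q i)) (fun i _ => ((hpq i).intertwines hΦ).mk_fix) (2 * ε / 3) (by
      refine (Filter.eventually_cofinite.1 (hS (ε / 3) (by positivity))).subset fun z hz => ?_
      simp only [Set.mem_ofPred_eq] at hz ⊢
      rw [← hS'] at hz
      intro hz'
      rw [dist_zero_right] at hz'
      have := entry S S' z
      have := norm_sub_norm_le (S' (δ z) z) (S (δ z) z)
      rw [norm_sub_rev] at this
      linarith [hd.1])
  refine Filter.eventually_cofinite.2 (key.subset fun z hz => ?_)
  simp only [Set.mem_ofPred_eq, dist_zero_right, not_lt] at hz ⊢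
  rw [← hT']
  have := entry T T' z
  have := norm_sub_norm_le (T (δ z) z) (T' (δ z) z)
  linarith [hd.2]

/-! ### An asymptotically invariant family of square roots of probability measures -/

open Classical in
/-- The number of `j < n` with `γ^j x = z`. -/
def visits (γ : AlmostPerm) (n x z : ℕ) : ℝ :=
  ∑ j ∈ Finset.range n, if γ.toPartialEquiv^[j] x = z then 1 else 0

/-- The square root of the mass at `z` of the uniform measure on `x, γ x, …, γ^(n-1) x`. -/
def ξ (γ : AlmostPerm) (n x z : ℕ) : ℝ := Real.sqrt (visits γ n x z / n)

/-- The partial bijection `p` moves points by at most `ℓ`, as seen by the measures `visits`. -/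
def DispLE (γ : AlmostPerm) (ℓ : ℝ) (p : PartialEquiv ℕ ℕ) : Prop :=
  ∀ (n : ℕ) (F : Finset ℕ), ∀ x ∈ p.source,
    ∑ z ∈ F, |visits γ n x z - visits γ n (p x) z| ≤ 2 * ℓ

theorem visits_nonneg (γ : AlmostPerm) (n x z : ℕ) : 0 ≤ visits γ n x z :=
  Finset.sum_nonneg fun j _ => by split_ifs <;> norm_num

theorem sum_visits_le (γ : AlmostPerm) (n x : ℕ) (F : Finset ℕ) :
    ∑ z ∈ F, visits γ n x z ≤ n := by
  classical
  simp only [visits]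
  rw [Finset.sum_comm]
  refine (Finset.sum_le_card_nsmul _ _ 1 fun j _ => ?_).trans (by simp)
  rw [Finset.sum_ite_eq]
  split_ifs <;> norm_num

theorem sum_visits_eq {n x : ℕ} {F : Finset ℕ}
    (hF : ∀ j < n, γ.toPartialEquiv^[j] x ∈ F) : ∑ z ∈ F, visits γ n x z = n := by
  classical
  simp only [visits]
  rw [Finset.sum_comm, Finset.sum_congr rfl fun j hj => ?_, Finset.sum_const, Finset.card_range,
    nsmul_eq_mul, mul_one]
  rw [Finset.sum_ite_eq, if_pos (hF j (Finset.mem_range.1 hj))]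

theorem exists_iterate_eq_of_visits_ne_zero {n x z : ℕ} (h : visits γ n x z ≠ 0) :
    ∃ j < n, γ.toPartialEquiv^[j] x = z := by
  by_contra hc
  push Not at hc
  exact h (Finset.sum_eq_zero fun j hj => if_neg (hc j (Finset.mem_range.1 hj)))

/-- The orbit segments starting at x and at γ x differ only by the endpoints x and γ^n x; the
difference telescopes. Nothing is required of the values that the total function underlying γ takes
off the domain. -/
theorem dispLE_base (γ : AlmostPerm) : DispLE γ 1 γ.toPartialEquiv := by
  classical
  intro n F x _
  have h : ∀ z, |visits γ n x z - visits γ n (γ.toPartialEquiv x) z| ≤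
      (if x = z then 1 else 0) + if γ.toPartialEquiv^[n] x = z then 1 else 0 := fun z => by
    have := Finset.sum_range_sub
      (fun j => if γ.toPartialEquiv^[j] x = z then (1 : ℝ) else 0) n
    rw [Finset.sum_sub_distrib] at this
    have e : visits γ n (γ.toPartialEquiv x) z - visits γ n x z = _ := this
    rw [abs_sub_comm, e, Function.iterate_zero, id]
    refine (abs_sub _ _).trans_eq ?_
    rw [add_comm]
    congr 1 <;> split_ifs <;> simp
  refine (Finset.sum_le_sum fun z _ => h z).trans ?_
  rw [Finset.sum_add_distrib, Finset.sum_ite_eq, Finset.sum_ite_eq]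
  split_ifs <;> norm_num

theorem DispLE.symm {ℓ : ℝ} (h : DispLE γ ℓ p) : DispLE γ ℓ p.symm := by
  intro n F y hy
  have := h n F (p.symm y) (p.map_target hy)
  rw [p.right_inv hy] at this
  simpa only [abs_sub_comm] using this

theorem DispLE.trans {ℓ ℓ' : ℝ} (h : DispLE γ ℓ p) (h' : DispLE γ ℓ' q) :
    DispLE γ (ℓ + ℓ') (p.trans q) := by
  intro n F x hx
  rw [PartialEquiv.trans_source] at hx
  rw [PartialEquiv.coe_trans, Function.comp_apply, mul_add]
  refine le_trans ?_ (add_le_add (h n F x hx.1) (h' n F (p x) hx.2))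
  rw [← Finset.sum_add_distrib]
  exact Finset.sum_le_sum fun z _ => abs_sub_le _ _ _

theorem Corr.exists_dispLE (h : Corr γ γ' Φ p q) : ∃ ℓ, DispLE γ ℓ p := by
  induction h with
  | base => exact ⟨1, dispLE_base γ⟩
  | ofSet h => exact ⟨0, fun n F x _ => by simp⟩
  | symm _ ih => obtain ⟨ℓ, h⟩ := ih; exact ⟨ℓ, h.symm⟩
  | trans _ _ ih ih' =>
    obtain ⟨ℓ, h⟩ := ih
    obtain ⟨ℓ', h'⟩ := ih'
    exact ⟨_, h.trans h'⟩

theorem ξ_nonneg (γ : AlmostPerm) (n x z : ℕ) : 0 ≤ ξ γ n x z := Real.sqrt_nonneg _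

theorem ξ_sq (γ : AlmostPerm) (n x z : ℕ) : ξ γ n x z ^ 2 = visits γ n x z / n :=
  Real.sq_sqrt (div_nonneg (visits_nonneg _ _ _ _) n.cast_nonneg)

theorem sum_ξ_sq_le (γ : AlmostPerm) (n x : ℕ) (F : Finset ℕ) :
    ∑ z ∈ F, ξ γ n x z ^ 2 ≤ 1 := by
  simp only [ξ_sq, ← Finset.sum_div]
  exact div_le_one_of_le₀ (sum_visits_le γ n x F) n.cast_nonneg

theorem ξ_le_one (γ : AlmostPerm) (n x z : ℕ) : ξ γ n x z ≤ 1 := by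
  have := sum_ξ_sq_le γ n x {z}
  rw [Finset.sum_singleton] at this
  exact (sq_le_one_iff₀ (ξ_nonneg γ n x z)).1 this

theorem norm_ξ_le (γ : AlmostPerm) (n z x : ℕ) : ‖(ξ γ n x z : ℂ)‖ ≤ 1 := by
  rw [Complex.norm_real, Real.norm_of_nonneg (ξ_nonneg _ _ _ _)]
  exact ξ_le_one _ _ _ _

/-- The kernel `∑ z, ξ_x(z) ξ_y(z)` is nearly one at nearby points. -/
theorem abs_one_sub_sum_ξ_le {ℓ : ℝ} (h : DispLE γ ℓ p) {n : ℕ} (hn : 0 < n) {F : Finset ℕ} {x : ℕ}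
    (hx : x ∈ p.source) (hFx : ∀ j < n, γ.toPartialEquiv^[j] x ∈ F)
    (hFy : ∀ j < n, γ.toPartialEquiv^[j] (p x) ∈ F) :
    |1 - ∑ z ∈ F, ξ γ n (p x) z * ξ γ n x z| ≤ ℓ / n := by
  have hn' : (0 : ℝ) < n := by exact_mod_cast hn
  have e1 : ∑ z ∈ F, ξ γ n x z ^ 2 = 1 := by
    simp only [ξ_sq, ← Finset.sum_div]
    rw [sum_visits_eq hFx, div_self hn'.ne']
  have e2 : ∑ z ∈ F, ξ γ n (p x) z ^ 2 = 1 := by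
    simp only [ξ_sq, ← Finset.sum_div]
    rw [sum_visits_eq hFy, div_self hn'.ne']
  -- For unit vectors, 1 minus the inner product is half the squared distance.
  have e3 : ∑ z ∈ F, (ξ γ n x z - ξ γ n (p x) z) ^ 2 =
      2 * (1 - ∑ z ∈ F, ξ γ n (p x) z * ξ γ n x z) := by
    have : ∀ z, (ξ γ n x z - ξ γ n (p x) z) ^ 2 =
        ξ γ n x z ^ 2 + ξ γ n (p x) z ^ 2 - 2 * (ξ γ n (p x) z * ξ γ n x z) := fun z => by ring
    simp only [this]
    rw [Finset.sum_sub_distrib, Finset.sum_add_distrib, e1, e2, ← Finset.mul_sum]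
    ring
  have h0 : 0 ≤ ∑ z ∈ F, (ξ γ n x z - ξ γ n (p x) z) ^ 2 :=
    Finset.sum_nonneg fun z _ => sq_nonneg _
  -- Termwise (√a - √b)² ≤ |a - b|, which turns the ℓ¹ estimate on visits into an ℓ² estimate.
  have h1 : ∑ z ∈ F, (ξ γ n x z - ξ γ n (p x) z) ^ 2 ≤ 2 * ℓ / n := by
    refine le_trans (Finset.sum_le_sum (g := fun z =>
      |visits γ n x z - visits γ n (p x) z| / n) fun z _ => ?_) ?_
    · have e : visits γ n x z / n - visits γ n (p x) z / n =
          (ξ γ n x z - ξ γ n (p x) z) * (ξ γ n x z + ξ γ n (p x) z) := by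
        rw [← ξ_sq, ← ξ_sq]; ring
      have e' : |visits γ n x z - visits γ n (p x) z| / n =
          |ξ γ n x z - ξ γ n (p x) z| * |ξ γ n x z + ξ γ n (p x) z| := by
        rw [← abs_mul, ← e, ← sub_div, abs_div, abs_of_pos hn']
      rw [e', ← sq_abs, sq]
      refine mul_le_mul_of_nonneg_left ?_ (abs_nonneg _)
      have hx0 := ξ_nonneg γ n x z
      have hy0 := ξ_nonneg γ n (p x) z
      rw [abs_of_nonneg (add_nonneg hx0 hy0), abs_le]
      constructor <;> linarith
    · rw [← Finset.sum_div]
      gcongr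
      exact h n F x hx
  rw [e3] at h0 h1
  rw [abs_of_nonneg (by linarith)]
  rw [mul_div_assoc] at h1
  linarith

/-! ### Averaged compressions -/

/-- The diagonal operator with entries `ξ_x(z)`, `x ∈ ℕ`. -/
def localizer (γ : AlmostPerm) (n z : ℕ) : H →L[ℂ] H := diagOp fun x => (ξ γ n x z : ℂ)

/-- The partial sum over `z ∈ F` of the Schur multiplier with kernel `∑ z, ξ_x(z) ξ_y(z)`. -/
def fejer (γ : AlmostPerm) (n : ℕ) (F : Finset ℕ) (T : H →L[ℂ] H) : H →L[ℂ] H :=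
  ∑ z ∈ F, localizer γ n z * T * localizer γ n z

theorem localizer_apply (γ : AlmostPerm) (n z : ℕ) (u : H) (x : ℕ) :
    localizer γ n z u x = ξ γ n x z * u x := diagOp_apply (norm_ξ_le γ n z) u x

theorem star_localizer (γ : AlmostPerm) (n z : ℕ) : star (localizer γ n z) = localizer γ n z := by
  rw [localizer, star_diagOp (norm_ξ_le γ n z)]
  simp only [Complex.conj_ofReal]

theorem proj_mul_localizer (A : Set ℕ) (γ : AlmostPerm) (n z : ℕ) :
    proj A * localizer γ n z = localizer γ n z * proj A := by
  rw [proj, localizer, diagOp_mul_diagOp (norm_indicator_one_le A) (norm_ξ_le γ n z),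
    diagOp_mul_diagOp (norm_ξ_le γ n z) (norm_indicator_one_le A)]
  simp only [mul_comm]

theorem proj_mul_proj (A B : Set ℕ) : proj A * proj B = proj B * proj A := by
  rw [proj, proj, diagOp_mul_diagOp (norm_indicator_one_le A) (norm_indicator_one_le B),
    diagOp_mul_diagOp (norm_indicator_one_le B) (norm_indicator_one_le A)]
  simp only [mul_comm]

theorem star_proj (A : Set ℕ) : star (proj A) = proj A := by
  rw [proj_eq_V, star_V]; rfl

/-- The sum of the squared localizers is diagonal with entries ∑ z, ξ_x(z)² ≤ 1. -/
theorem sum_norm_localizer_sq_le (γ : AlmostPerm) (n : ℕ) (F : Finset ℕ) (u : H) :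
    ∑ z ∈ F, ‖localizer γ n z u‖ ^ 2 ≤ ‖u‖ ^ 2 := by
  have h := hasSum_sum (s := F) fun z _ => norm_sq_eq_tsum (localizer γ n z u)
  refine hasSum_le (fun x => ?_) h (norm_sq_eq_tsum u)
  have : ∀ z, ‖localizer γ n z u x‖ ^ 2 = ξ γ n x z ^ 2 * ‖u x‖ ^ 2 := fun z => by
    rw [localizer_apply, norm_mul, mul_pow, Complex.norm_real, Real.norm_eq_abs, sq_abs]
  simp only [this]
  rw [← Finset.sum_mul]
  exact mul_le_of_le_one_left (sq_nonneg _) (sum_ξ_sq_le γ n x F)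

theorem inner_star_mul (A X : H →L[ℂ] H) (u w : H) :
    inner ℂ ((A * X) u) w = inner ℂ (X u) ((star A : H →L[ℂ] H) w) := by
  rw [ContinuousLinearMap.star_eq_adjoint, ContinuousLinearMap.adjoint_inner_right]; rfl

theorem opNorm_le_of_inner {X : H →L[ℂ] H} {C : ℝ} (hC : 0 ≤ C)
    (h : ∀ u w, ‖inner ℂ (X u) w‖ ≤ C * ‖u‖ * ‖w‖) : ‖X‖ ≤ C := by
  refine X.opNorm_le_bound hC fun u => ?_
  have h1 := h u (X u)
  rw [inner_self_eq_norm_sq_to_K, norm_pow, RCLike.norm_ofReal, abs_norm, sq] at h1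
  rcases (norm_nonneg (X u)).eq_or_lt with h0 | h0
  · rw [← h0]; positivity
  · exact le_of_mul_le_mul_right h1 h0

/-- Cauchy–Schwarz over z. Only the form of T on the range of each single localizer matters, so a
local bound on T becomes a norm bound on its average. -/
theorem norm_fejer_le_of_inner {n : ℕ} {F : Finset ℕ} {C : ℝ} (hC : 0 ≤ C)
    (h : ∀ z ∈ F, ∀ u w, ‖inner ℂ (T (localizer γ n z u)) (localizer γ n z w)‖ ≤
      C * (‖localizer γ n z u‖ * ‖localizer γ n z w‖)) : ‖fejer γ n F T‖ ≤ C := by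
  refine opNorm_le_of_inner hC fun u w => ?_
  have e : inner ℂ (fejer γ n F T u) w =
      ∑ z ∈ F, inner ℂ (T (localizer γ n z u)) (localizer γ n z w) := by
    rw [fejer, sum_apply, sum_inner]
    refine Finset.sum_congr rfl fun z _ => ?_
    rw [mul_assoc, inner_star_mul, star_localizer]; rfl
  rw [e]
  calc _ ≤ ∑ z ∈ F, C * (‖localizer γ n z u‖ * ‖localizer γ n z w‖) :=
        norm_sum_le_of_le _ fun z hz => h z hz u w
    _ = C * ∑ z ∈ F, ‖localizer γ n z u‖ * ‖localizer γ n z w‖ := by rw [Finset.mul_sum]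
    _ ≤ C * (‖u‖ * ‖w‖) := by
        gcongr
        refine (Real.sum_mul_le_sqrt_mul_sqrt F _ _).trans ?_
        gcongr
        · exact Real.sqrt_le_iff.2 ⟨norm_nonneg _, sum_norm_localizer_sq_le γ n F u⟩
        · exact Real.sqrt_le_iff.2 ⟨norm_nonneg _, sum_norm_localizer_sq_le γ n F w⟩
    _ = _ := (mul_assoc _ _ _).symm

theorem norm_fejer_le (γ : AlmostPerm) (n : ℕ) (F : Finset ℕ) (T : H →L[ℂ] H) :
    ‖fejer γ n F T‖ ≤ ‖T‖ :=
  norm_fejer_le_of_inner (norm_nonneg T) fun z _ u w =>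
    (norm_inner_le_norm _ _).trans (by
      rw [← mul_assoc]
      gcongr
      exact T.le_opNorm _)

theorem fejer_add (γ : AlmostPerm) (n : ℕ) (F : Finset ℕ) (S T : H →L[ℂ] H) :
    fejer γ n F (S + T) = fejer γ n F S + fejer γ n F T := by
  simp only [fejer, mul_add, add_mul, Finset.sum_add_distrib]

theorem fejer_sub (γ : AlmostPerm) (n : ℕ) (F : Finset ℕ) (S T : H →L[ℂ] H) :
    fejer γ n F (S - T) = fejer γ n F S - fejer γ n F T := by
  simp only [fejer, mul_sub, sub_mul, Finset.sum_sub_distrib]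

theorem fejer_smul (γ : AlmostPerm) (n : ℕ) (F : Finset ℕ) (c : ℂ) (T : H →L[ℂ] H) :
    fejer γ n F (c • T) = c • fejer γ n F T := by
  simp only [fejer, mul_smul_comm, smul_mul_assoc, Finset.smul_sum]

theorem fejer_proj (γ : AlmostPerm) (n : ℕ) (F : Finset ℕ) (A : Set ℕ) (T : H →L[ℂ] H) :
    fejer γ n F (proj A * T * proj A) = proj A * fejer γ n F T * proj A := by
  simp only [fejer, Finset.mul_sum, Finset.sum_mul]
  refine Finset.sum_congr rfl fun z _ => ?_
  calc localizer γ n z * (proj A * T * proj A) * localizer γ n z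
      = (localizer γ n z * proj A) * T * (proj A * localizer γ n z) := by simp only [mul_assoc]
    _ = (proj A * localizer γ n z) * T * (localizer γ n z * proj A) := by
        rw [proj_mul_localizer]
    _ = _ := by simp only [mul_assoc]

theorem norm_proj_mul_proj_le (A : Set ℕ) (X : H →L[ℂ] H) : ‖proj A * X * proj A‖ ≤ ‖X‖ := by
  calc ‖proj A * X * proj A‖ ≤ ‖proj A‖ * ‖X‖ * ‖proj A‖ :=
        (norm_mul_le _ _).trans (by gcongr; exact norm_mul_le _ _)
    _ ≤ 1 * ‖X‖ * 1 := by gcongr <;> exact norm_proj_le A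
    _ = ‖X‖ := by ring

/-- Averaging multiplies each matrix entry by the kernel, so in the corner of s the difference is a
weighted shift along p with weights 1 - ∑ z, ξ_y(z) ξ_x(z), where y = p x. -/
theorem norm_proj_V_sub_fejer_le {ℓ : ℝ} (h : DispLE γ ℓ p) {n : ℕ} (hn : 0 < n) (hℓ : 0 ≤ ℓ)
    {s F : Finset ℕ} (hF : ∀ x ∈ s, ∀ j < n, γ.toPartialEquiv^[j] x ∈ F) :
    ‖proj s * (V p - fejer γ n F (V p)) * proj s‖ ≤ ℓ / n := by
  classical
  let a : ℕ → ℂ := fun y => if y ∈ p.target ∧ y ∈ s ∧ p.symm y ∈ s then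
    ((1 - ∑ z ∈ F, ξ γ n y z * ξ γ n (p.symm y) z : ℝ) : ℂ) else 0
  have ha : ∀ y, ‖a y‖ ≤ ℓ / n := fun y => by
    simp only [a]
    split_ifs with hy
    · obtain ⟨hy, hys, hxs⟩ := hy
      have := abs_one_sub_sum_ξ_le (F := F) h hn (p.map_target hy) (hF _ hxs)
        (by rw [p.right_inv hy]; exact hF _ hys)
      rw [p.right_inv hy] at this
      rwa [Complex.norm_real, Real.norm_eq_abs]
    · rw [norm_zero]; positivity
  have e : proj s * (V p - fejer γ n F (V p)) * proj s = weighted a p := by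
    ext u y
    rw [weighted_apply ha, mul_apply_eq_comp, mul_apply_eq_comp, proj_apply, Set.indicator_apply,
      sub_apply, lp.coeFn_sub, Pi.sub_apply, fejer, sum_apply, lp.coeFn_sum, Finset.sum_apply]
    simp only [mul_apply_eq_comp, localizer_apply, V_apply, proj_apply, Set.indicator_apply, a,
      Finset.mem_coe]
    by_cases h1 : y ∈ p.target <;> by_cases h2 : y ∈ s <;> by_cases h3 : p.symm y ∈ s <;>
      simp only [h1, h2, h3, if_true, if_false, and_true, and_false, mul_zero, zero_mul,
        Finset.sum_const_zero, sub_zero]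
    rw [Complex.ofReal_sub, Complex.ofReal_one, Complex.ofReal_sum, sub_mul, one_mul,
      Finset.sum_mul]
    congr 1
    refine Finset.sum_congr rfl fun z _ => ?_
    rw [Complex.ofReal_mul, mul_assoc]
  rw [e]
  exact norm_weighted_le ha p

/-- The averaged compressions of `T` converge to `T`, uniformly in `n`. -/
def FejerApprox (γ : AlmostPerm) (T : H →L[ℂ] H) : Prop :=
  ∀ ε > 0, ∀ᶠ n in Filter.atTop, ∀ s : Finset ℕ, ∀ᶠ F in Filter.atTop,
    ‖proj s * (T - fejer γ n F T) * proj s‖ ≤ ε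

theorem fejerApprox_V {ℓ : ℝ} (h : DispLE γ ℓ p) : FejerApprox γ (V p) := by
  classical
  -- A partial bijection with empty source allows a negative ℓ.
  have h' : DispLE γ |ℓ| p := fun n F x hx => (h n F x hx).trans (by gcongr; exact le_abs_self ℓ)
  intro ε hε
  filter_upwards [Filter.eventually_gt_atTop 0,
    (tendsto_const_div_atTop_nhds_zero_nat |ℓ|).eventually (gt_mem_nhds hε)] with n hn hn' s
  filter_upwards [Filter.eventually_ge_atTop
    (s.biUnion fun x => (Finset.range n).image fun j => γ.toPartialEquiv^[j] x)] with F hF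
  refine (norm_proj_V_sub_fejer_le h' hn (abs_nonneg ℓ) fun x hx j hj => ?_).trans hn'.le
  exact hF (Finset.mem_biUnion.2 ⟨x, hx, Finset.mem_image_of_mem _ (Finset.mem_range.2 hj)⟩)

theorem FejerApprox.add (hS : FejerApprox γ S) (hT : FejerApprox γ T) : FejerApprox γ (S + T) := by
  intro ε hε
  filter_upwards [hS (ε / 2) (by positivity), hT (ε / 2) (by positivity)] with n h1 h2 s
  filter_upwards [h1 s, h2 s] with F h1 h2
  have e : proj s * (S + T - fejer γ n F (S + T)) * proj s =
      proj s * (S - fejer γ n F S) * proj s + proj s * (T - fejer γ n F T) * proj s := by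
    rw [fejer_add, ← add_mul, ← mul_add]
    congr 2
    abel
  rw [e]
  exact (norm_add_le _ _).trans (by linarith)

theorem FejerApprox.smul (c : ℂ) (hT : FejerApprox γ T) : FejerApprox γ (c • T) := by
  intro ε hε
  filter_upwards [hT (ε / (‖c‖ + 1)) (by positivity)] with n h s
  filter_upwards [h s] with F h
  rw [fejer_smul, ← smul_sub, mul_smul_comm, smul_mul_assoc, norm_smul]
  calc ‖c‖ * _ ≤ (‖c‖ + 1) * (ε / (‖c‖ + 1)) := by gcongr; linarith
    _ = ε := by field_simp

theorem FejerApprox.of_mem_closure {E : Set (H →L[ℂ] H)} (hE : ∀ S ∈ E, FejerApprox γ S)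
    (hT : T ∈ closure E) : FejerApprox γ T := by
  intro ε hε
  obtain ⟨S, hS, hd⟩ := Metric.mem_closure_iff.1 hT (ε / 3) (by positivity)
  rw [dist_eq_norm] at hd
  filter_upwards [hE S hS (ε / 3) (by positivity)] with n h s
  filter_upwards [h s] with F h
  have e : proj s * (T - fejer γ n F T) * proj s =
      proj s * (T - S) * proj s - proj s * fejer γ n F (T - S) * proj s +
        proj s * (S - fejer γ n F S) * proj s := by
    rw [fejer_sub]
    noncomm_ring
  rw [e]
  have h1 := norm_proj_mul_proj_le s (T - S)
  have h2 := (norm_proj_mul_proj_le s (fejer γ n F (T - S))).trans (norm_fejer_le _ _ _ _)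
  have h3 := norm_add_le (proj s * (T - S) * proj s - proj s * fejer γ n F (T - S) * proj s)
    (proj s * (S - fejer γ n F S) * proj s)
  have h4 := norm_sub_le (proj s * (T - S) * proj s) (proj s * fejer γ n F (T - S) * proj s)
  linarith

/-- Approximability holds for each V p, whose displacement is bounded, and is kept by linear
combinations and norm limits because the averages are contractive. -/
theorem fejerApprox_of_mem_corrCStar (h : (S, T) ∈ corrCStar γ γ' Φ) : FejerApprox γ S := by
  rw [mem_corrCStar_iff] at h
  have := map_mem_closure (f := Prod.fst) (t := {X | FejerApprox γ X})
    continuous_fst h fun x hx => ?_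
  · exact FejerApprox.of_mem_closure (fun _ h => h) this
  · rw [SetLike.mem_coe] at hx
    change FejerApprox γ x.1
    induction hx using Submodule.span_induction with
    | mem x hx =>
      obtain ⟨p, q, h, rfl⟩ := hx
      obtain ⟨ℓ, hℓ⟩ := h.exists_dispLE
      exact fejerApprox_V hℓ
    | zero => simpa using (fejerApprox_V (dispLE_base γ)).smul 0
    | add x y _ _ hx hy => exact hx.add hy
    | smul c x _ hx => exact hx.smul c

/-! ### Compact operators -/

theorem isCompactOperator_proj {A : Set ℕ} (hA : A.Finite) : IsCompactOperator (proj A) := by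
  classical
  obtain ⟨s, rfl⟩ := hA.exists_finset_coe
  have e : proj s = ∑ i ∈ s, (ContinuousLinearMap.toSpanSingleton ℂ (δ i)).comp
      (innerSL ℂ (δ i)) := by
    ext1 u
    rw [proj_finset_apply, sum_apply]
    refine Finset.sum_congr rfl fun i _ => ?_
    simp [inner_δ_left]
  rw [e]
  refine Submodule.sum_mem (compactOperator (RingHom.id ℂ) H H) fun i _ => ?_
  exact (isCompactOperator_of_locallyCompactSpace_rng
    (ContinuousLinearMap.toSpanSingleton ℂ (δ i))).comp_clm (innerSL ℂ (δ i))

theorem tendsto_apply_cofinite (u : H) :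
    Filter.Tendsto (fun z => u z) Filter.cofinite (nhds 0) := by
  rw [tendsto_zero_iff_norm_tendsto_zero]
  have h := (norm_sq_eq_tsum u).summable.tendsto_cofinite_zero
  have := (Real.continuous_sqrt.tendsto 0).comp h
  simpa [Function.comp_def, Real.sqrt_sq] using this

/-- The diagonal entries of a compact operator tend to zero. -/
theorem tendsto_diag_of_isCompactOperator (hT : IsCompactOperator T) :
    Filter.Tendsto (fun z => T (δ z) z) Filter.cofinite (nhds 0) := by
  obtain ⟨K, hK, hsub⟩ := IsCompactOperator.image_closedBall_subset_compact
    (f := (T : H →ₗ[ℂ] H)) hT 1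
  rw [Metric.tendsto_nhds]
  intro ε hε
  -- All T δ_z lie near a finite set of vectors, and the z-th coordinate of each of these vectors
  -- tends to zero.
  obtain ⟨t, htf, ht⟩ := Metric.totallyBounded_iff.1 hK.totallyBounded (ε / 2) (half_pos hε)
  have h1 : ∀ᶠ z in Filter.cofinite, ∀ k ∈ t, ‖k z‖ < ε / 2 :=
    (Filter.eventually_all_finite htf).2 fun k _ => by
      simpa using Metric.tendsto_nhds.1 (tendsto_apply_cofinite k) (ε / 2) (half_pos hε)
  filter_upwards [h1] with z hz
  have hmem : T (δ z) ∈ K := hsub ⟨δ z, by simp [norm_δ], rfl⟩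
  obtain ⟨k, hk, hd⟩ := Set.mem_iUnion₂.1 (ht hmem)
  rw [Metric.mem_ball, dist_eq_norm] at hd
  have h2 : ‖T (δ z) z - k z‖ ≤ ‖T (δ z) - k‖ := norm_apply_le (T (δ z) - k) z
  have h3 := norm_sub_norm_le (T (δ z) z) (k z)
  rw [dist_zero_right]
  linarith [hz k hk]

/-- Crude expansion into card² terms. This suffices because the supports to which it is applied have
at most n points, with n chosen before the bound on the entries. -/
theorem norm_inner_le_of_entry_le {B : Finset ℕ} {ε : ℝ}
    (h : ∀ x ∈ B, ∀ y ∈ B, ‖T (δ x) y‖ ≤ ε) {a b : H} (ha : proj B a = a) (hb : proj B b = b) :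
    ‖inner ℂ (T a) b‖ ≤ (B.card : ℝ) ^ 2 * ε * (‖a‖ * ‖b‖) := by
  rw [proj_finset_apply] at ha hb
  have e : inner ℂ (T a) b = ∑ x ∈ B, ∑ y ∈ B, inner ℂ (T (a x • δ x)) (b y • δ y) := by
    conv_lhs => rw [← ha, ← hb]
    rw [map_sum, sum_inner]
    exact Finset.sum_congr rfl fun x _ => inner_sum _ _ _
  rw [e]
  calc _ ≤ ∑ x ∈ B, ∑ y ∈ B, ε * (‖a‖ * ‖b‖) := by
        refine norm_sum_le_of_le _ fun x hx => norm_sum_le_of_le _ fun y hy => ?_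
        rw [map_smul, inner_smul_left, inner_smul_right, inner_δ_right, norm_mul, norm_mul,
          RCLike.norm_conj, RCLike.norm_conj]
        have hε : 0 ≤ ε := (norm_nonneg _).trans (h x hx y hy)
        calc ‖a x‖ * (‖b y‖ * ‖T (δ x) y‖) ≤ ‖a‖ * (‖b‖ * ε) := by
              gcongr
              · exact norm_apply_le a x
              · exact norm_apply_le b y
              · exact h x hx y hy
          _ = ε * (‖a‖ * ‖b‖) := by ring
    _ = _ := by
        simp only [Finset.sum_const, nsmul_eq_mul]
        ring

/-! ### Iterates of an almost permutation -/

/-- The map is finite-to-one: it is injective on a cofinite set. Hence a condition holding at almost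
all points can be imposed along whole orbit segments. -/
theorem tendsto_iterate_cofinite (γ : AlmostPerm) (i : ℕ) :
    Filter.Tendsto (γ.toPartialEquiv^[i]) Filter.cofinite Filter.cofinite := by
  refine Filter.Tendsto.iterate ?_ i
  intro A hA
  rw [Filter.mem_cofinite] at hA
  rw [Filter.mem_map, Filter.mem_cofinite]
  refine (γ.finite_compl_source.union (hA.image γ.toPartialEquiv.symm)).subset fun x hx => ?_
  by_cases hs : x ∈ γ.source
  · exact Or.inr ⟨γ.toPartialEquiv x, hx, γ.left_inv hs⟩
  · exact Or.inl hs

theorem star_v_pow_δ {i x : ℕ} (h : ∀ k < i, γ.toPartialEquiv^[k] x ∈ γ.source) :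
    (star (v γ) ^ i : H →L[ℂ] H) (δ (γ.toPartialEquiv^[i] x)) = δ x := by
  induction i with
  | zero => simp
  | succ i ih =>
    have hi := h i i.lt_succ_self
    rw [pow_succ, mul_apply_eq_comp, Function.iterate_succ_apply', ← V_eq_v, star_V,
      V_δ_of_mem (p := γ.toPartialEquiv.symm) (γ.map_source hi), γ.left_inv hi, ← star_V, V_eq_v]
    exact ih fun k hk => h k (hk.trans i.lt_succ_self)

theorem symm_iterate_iterate {i x : ℕ} (h : ∀ k < i, γ.toPartialEquiv^[k] x ∈ γ.source) :
    γ.toPartialEquiv.symm^[i] (γ.toPartialEquiv^[i] x) = x := by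
  induction i with
  | zero => rfl
  | succ i ih =>
    rw [Function.iterate_succ_apply, Function.iterate_succ_apply' γ.toPartialEquiv,
      γ.left_inv (h i i.lt_succ_self)]
    exact ih fun k hk => h k (hk.trans i.lt_succ_self)

/-- If the orbits of x and y meet at z after i and j steps, then v*^i δ_z = δ_x and v*^j δ_z = δ_y,
so the entry of T at (x, y) becomes a diagonal entry at z. -/
theorem entry_eq_diag_entry {i j x y : ℕ} (hx : ∀ k < i, γ.toPartialEquiv^[k] x ∈ γ.source)
    (hy : ∀ k < j, γ.toPartialEquiv^[k] y ∈ γ.source)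
    (h : γ.toPartialEquiv^[i] x = γ.toPartialEquiv^[j] y) :
    T (δ x) y = (v γ ^ j * T * star (v γ) ^ i : H →L[ℂ] H) (δ (γ.toPartialEquiv^[i] x))
      (γ.toPartialEquiv^[i] x) := by
  rw [← inner_δ_left y, ← inner_δ_left (γ.toPartialEquiv^[i] x), mul_apply_eq_comp, star_v_pow_δ hx,
    ← inner_conj_symm, ← inner_conj_symm (δ (γ.toPartialEquiv^[i] x)), inner_star_mul, star_pow, h,
    star_v_pow_δ hy]

/-! ### The diagonal criterion for compactness. -/

/-- An operator approximated by its averaged compressions all of whose diagonals along `γ` vanish at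
infinity is compact. -/
theorem isCompactOperator_of_tendsto_diag (hT : FejerApprox γ T)
    (h : ∀ i j : ℕ, Filter.Tendsto
      (fun z => (v γ ^ j * T * star (v γ) ^ i : H →L[ℂ] H) (δ z) z) Filter.cofinite (nhds 0)) :
    IsCompactOperator T := by
  classical
  have hcl : IsClosed {X : H →L[ℂ] H | IsCompactOperator X} := isClosed_setOfPred_isCompactOperator
  suffices hT' : T ∈ closure {X : H →L[ℂ] H | IsCompactOperator X} by rwa [hcl.closure_eq] at hT'
  rw [Metric.mem_closure_iff]
  intro ε hε
  obtain ⟨n, hn⟩ := (hT (ε / 4) (by positivity)).exists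
  -- Chosen so that n² entries of size ε' contribute at most ε/4.
  let ε' : ℝ := ε / (4 * ((n : ℝ) ^ 2 + 1))
  have hε' : 0 < ε' := by positivity
  have hnε : (n : ℝ) ^ 2 * ε' ≤ ε / 4 := by
    rw [show ε' = ε / 4 / ((n : ℝ) ^ 2 + 1) by simp only [ε']; field_simp, mul_div_assoc',
      div_le_iff₀ (by positivity)]
    nlinarith
  -- Almost every x has its first n iterates inside the domain and at points where all n² diagonals
  -- in question are below ε'. The set G collects these x.
  have hev : ∀ᶠ x in Filter.cofinite, ∀ k ∈ Set.Iio n, γ.toPartialEquiv^[k] x ∈ γ.source ∧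
      ∀ i ∈ Set.Iio n, ∀ j ∈ Set.Iio n, ‖(v γ ^ j * T * star (v γ) ^ i : H →L[ℂ] H)
        (δ (γ.toPartialEquiv^[k] x)) (γ.toPartialEquiv^[k] x)‖ < ε' := by
    refine (Filter.eventually_all_finite (Set.finite_Iio n)).2 fun k _ => ?_
    refine (tendsto_iterate_cofinite γ k).eventually (p := fun z => z ∈ γ.source ∧
      ∀ i ∈ Set.Iio n, ∀ j ∈ Set.Iio n,
        ‖(v γ ^ j * T * star (v γ) ^ i : H →L[ℂ] H) (δ z) z‖ < ε') ?_
    refine Filter.Eventually.and γ.finite_compl_source ?_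
    refine (Filter.eventually_all_finite (Set.finite_Iio n)).2 fun i _ =>
      (Filter.eventually_all_finite (Set.finite_Iio n)).2 fun j _ => ?_
    simpa using Metric.tendsto_nhds.1 (h i j) ε' hε'
  obtain ⟨G, hG, hGfin⟩ : ∃ G : Set ℕ, (∀ x ∈ G, ∀ k < n, γ.toPartialEquiv^[k] x ∈ γ.source ∧
      ∀ i < n, ∀ j < n, ‖(v γ ^ j * T * star (v γ) ^ i : H →L[ℂ] H)
        (δ (γ.toPartialEquiv^[k] x)) (γ.toPartialEquiv^[k] x)‖ < ε') ∧ Gᶜ.Finite :=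
    ⟨_, fun x hx => hx, hev⟩
  have hfejer : ∀ F, ‖fejer γ n F (proj G * T * proj G)‖ ≤ ε / 4 := fun F => by
    refine norm_fejer_le_of_inner (by positivity) fun z _ u w => ?_
    -- The points of G that reach z in fewer than n steps. Each equals γ⁻ⁱ z for some i < n, so
    -- there are at most n of them, and any two have orbits meeting at z.
    let B : Finset ℕ :=
      ((Finset.range n).image fun i => γ.toPartialEquiv.symm^[i] z).filter
        fun x => x ∈ G ∧ ∃ i < n, γ.toPartialEquiv^[i] x = z
    have hB : ∀ u : H, proj B (proj G (localizer γ n z u)) = proj G (localizer γ n z u) := by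
      intro u
      ext x
      rw [proj_apply, Set.indicator_apply, ite_eq_left_iff]
      intro hx
      rw [proj_apply, Set.indicator_apply]
      split_ifs with hxG
      · rw [localizer_apply]
        by_cases hv : visits γ n x z = 0
        · rw [ξ, hv, zero_div, Real.sqrt_zero, Complex.ofReal_zero, zero_mul]
        · obtain ⟨i, hi, hiz⟩ := exists_iterate_eq_of_visits_ne_zero hv
          refine absurd (Finset.mem_coe.2 (Finset.mem_filter.2
            ⟨Finset.mem_image.2 ⟨i, Finset.mem_range.2 hi, ?_⟩, hxG, i, hi, hiz⟩)) hx
          rw [← hiz]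
          exact symm_iterate_iterate fun k hk => (hG x hxG k (hk.trans hi)).1
      · rfl
    have hcard : (B.card : ℝ) ≤ n := by
      exact_mod_cast (Finset.card_filter_le _ _).trans (Finset.card_image_le.trans (by simp))
    have hent : ∀ x ∈ B, ∀ y ∈ B, ‖T (δ x) y‖ ≤ ε' := by
      intro x hx y hy
      obtain ⟨-, hxG, i, hi, hiz⟩ := Finset.mem_filter.1 hx
      obtain ⟨-, hyG, j, hj, hjz⟩ := Finset.mem_filter.1 hy
      rw [entry_eq_diag_entry (γ := γ) (i := i) (j := j)
        (fun k hk => (hG x hxG k (hk.trans hi)).1) (fun k hk => (hG y hyG k (hk.trans hj)).1)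
        (hiz.trans hjz.symm)]
      exact ((hG x hxG i hi).2 i hi j hj).le
    rw [mul_assoc, inner_star_mul, star_proj, mul_apply_eq_comp]
    refine (norm_inner_le_of_entry_le hent (hB u) (hB w)).trans ?_
    have hc : ∀ u : H, ‖proj G u‖ ≤ ‖u‖ := fun u =>
      ((proj G).le_opNorm u).trans (mul_le_of_le_one_left (norm_nonneg _) (norm_proj_le G))
    calc (B.card : ℝ) ^ 2 * ε' * (‖proj G (localizer γ n z u)‖ * ‖proj G (localizer γ n z w)‖)
        ≤ (n : ℝ) ^ 2 * ε' * (‖localizer γ n z u‖ * ‖localizer γ n z w‖) := by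
          gcongr <;> exact hc _
      _ ≤ _ := by gcongr
  -- In each finite corner, replacing T by its average costs ε/4, and the average of the compression
  -- to G has norm at most ε/4.
  have hQ : ‖proj G * T * proj G‖ ≤ ε / 2 := by
    refine norm_le_of_forall_proj (by positivity) fun s => ?_
    obtain ⟨F, hF⟩ := (hn s).exists
    have e : proj s * (proj G * T * proj G) * proj s =
        proj G * (proj s * (T - fejer γ n F T) * proj s) * proj G +
          proj s * fejer γ n F (proj G * T * proj G) * proj s := by
      have e1 : ∀ X : H →L[ℂ] H, proj G * (proj s * X * proj s) * proj G =
          proj s * (proj G * X * proj G) * proj s := fun X => by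
        calc _ = (proj G * proj s) * X * (proj s * proj G) := by simp only [mul_assoc]
          _ = (proj s * proj G) * X * (proj G * proj s) := by
              rw [proj_mul_proj G s]
          _ = _ := by simp only [mul_assoc]
      rw [e1, fejer_proj]
      noncomm_ring
    rw [e]
    have h1 := (norm_proj_mul_proj_le G _).trans hF
    have h2 := (norm_proj_mul_proj_le s _).trans (hfejer F)
    exact (norm_add_le _ _).trans (by linarith)
  refine ⟨T - proj G * T * proj G, ?_, ?_⟩
  -- The complement of G is finite, so removing the corner of G from T leaves a compact operator.
  · have e : T - proj G * T * proj G = proj Gᶜ * T + (proj G * T) * proj Gᶜ := by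
      have : proj Gᶜ = 1 - proj G := by
        ext u j
        rw [sub_apply, lp.coeFn_sub, Pi.sub_apply, proj_apply, proj_apply, one_apply_eq_self]
        by_cases hj : j ∈ G <;> simp [hj]
      rw [this]
      noncomm_ring
    rw [e]
    have hc := isCompactOperator_proj hGfin
    exact (IsCompactOperator.comp_clm hc T).add (IsCompactOperator.clm_comp hc (proj G * T))
  · rw [dist_eq_norm, sub_sub_cancel]
    linarith

/-! ### The isomorphism of coronas -/

theorem v_mem_corrCStar (γ γ' : AlmostPerm) (Φ : PFin ≃o PFin) :
    (v γ, v γ') ∈ corrCStar γ γ' Φ := by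
  rw [← V_eq_v, ← V_eq_v]
  exact Corr.base.mem_corrCStar

/-- Multiplying the pair (S, T) by powers of (v_γ, v_γ') and their adjoints stays in the algebra and
keeps the first coordinate compact. So the diagonal of every v_γ'^j T v_γ'*^i vanishes at infinity,
and the diagonal criterion applies to T. -/
theorem isCompactOperator_of_mem_corrCStar (hΦ : ∀ x, Φ (γ.aut x) = γ'.aut (Φ x))
    (h : (S, T) ∈ corrCStar γ γ' Φ) (hS : IsCompactOperator S) : IsCompactOperator T := by
  refine isCompactOperator_of_tendsto_diag
    (fejerApprox_of_mem_corrCStar (swap_mem_corrCStar h)) fun i j => ?_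
  have hv := v_mem_corrCStar γ γ' Φ
  have hmem := mul_mem (mul_mem (pow_mem hv j) h) (pow_mem (star_mem hv) i)
  refine tendsto_diag_of_mem_corrCStar hΦ hmem (tendsto_diag_of_isCompactOperator ?_)
  exact IsCompactOperator.comp_clm (IsCompactOperator.clm_comp hS (v γ ^ j)) (star (v γ) ^ i)

/-- The quotient map onto the corona, as a `*`-homomorphism. -/
def toCoronaStar (γ : AlmostPerm) : uniformRoe γ →⋆ₐ[ℂ] Corona γ where
  toAlgHom := toCorona γ
  map_star' T := (star_toCorona γ T).symm

theorem toCoronaStar_eq_zero {X : uniformRoe γ} :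
    toCoronaStar γ X = 0 ↔ IsCompactOperator (X : H →L[ℂ] H) :=
  Ideal.Quotient.eq_zero_iff_mem

/-- The first coordinate of a corresponding pair, in the uniform Roe algebra. -/
def corrFst (γ γ' : AlmostPerm) (Φ : PFin ≃o PFin) : corrCStar γ γ' Φ →⋆ₐ[ℂ] uniformRoe γ :=
  ((StarAlgHom.fst ℂ (H →L[ℂ] H) (H →L[ℂ] H)).comp (corrCStar γ γ' Φ).subtype).codRestrict
    (uniformRoe γ) fun x => fst_mem_uniformRoe (T := x.1.2) x.2

/-- The second coordinate of a corresponding pair, in the uniform Roe algebra. -/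
def corrSnd (γ γ' : AlmostPerm) (Φ : PFin ≃o PFin) : corrCStar γ γ' Φ →⋆ₐ[ℂ] uniformRoe γ' :=
  ((StarAlgHom.snd ℂ (H →L[ℂ] H) (H →L[ℂ] H)).comp (corrCStar γ γ' Φ).subtype).codRestrict
    (uniformRoe γ') fun x => snd_mem_uniformRoe (S := x.1.1) x.2

theorem corrFst_surjective (γ γ' : AlmostPerm) (Φ : PFin ≃o PFin) :
    Function.Surjective (corrFst γ γ' Φ) := fun X => by
  obtain ⟨Y, hY⟩ := exists_mem_corrCStar γ' Φ X.2
  exact ⟨⟨_, hY⟩, rfl⟩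

theorem corrSnd_surjective (γ γ' : AlmostPerm) (Φ : PFin ≃o PFin) :
    Function.Surjective (corrSnd γ γ' Φ) := fun Y => by
  obtain ⟨X, hX⟩ := exists_mem_corrCStar γ Φ.symm Y.2
  have h : (X, (Y : H →L[ℂ] H)) ∈ corrCStar γ γ' Φ := by
    simpa only [OrderIso.symm_symm] using swap_mem_corrCStar hX
  exact ⟨⟨_, h⟩, rfl⟩

theorem toCoronaStar_surjective (γ : AlmostPerm) : Function.Surjective (toCoronaStar γ) :=
  Ideal.Quotient.mk_surjective

theorem exists_corona_starAlgEquiv (hΦ : ∀ x, Φ (γ.aut x) = γ'.aut (Φ x)) :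
    ∃ e : Corona γ ≃⋆ₐ[ℂ] Corona γ', e (vdot γ) = vdot γ' := by
  have hΦ' : ∀ x, Φ.symm (γ'.aut x) = γ.aut (Φ.symm x) := fun x => by
    rw [OrderIso.symm_apply_eq, hΦ, OrderIso.apply_symm_apply]
  obtain ⟨e, he⟩ := exists_starAlgEquiv_of_ker_eq
    ((toCoronaStar γ).comp (corrFst γ γ' Φ)) ((toCoronaStar γ').comp (corrSnd γ γ' Φ))
    ((toCoronaStar_surjective γ).comp (corrFst_surjective γ γ' Φ))
    ((toCoronaStar_surjective γ').comp (corrSnd_surjective γ γ' Φ)) fun x =>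
      (toCoronaStar_eq_zero.trans
        ⟨isCompactOperator_of_mem_corrCStar hΦ x.2,
          isCompactOperator_of_mem_corrCStar hΦ' (swap_mem_corrCStar x.2)⟩).trans
        toCoronaStar_eq_zero.symm
  exact ⟨e, he ⟨_, v_mem_corrCStar γ γ' Φ⟩⟩

end RoeCorona

end

theorem lemmaL (γ γ' : RoeCorona.AlmostPerm) (h : RoeCorona.Conjugate γ.aut γ'.aut) :
    ∃ e : RoeCorona.Corona γ ≃⋆ₐ[ℂ] RoeCorona.Corona γ',
      e (RoeCorona.vdot γ) = RoeCorona.vdot γ' := by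
  obtain ⟨Φ, hΦ⟩ := h
  exact RoeCorona.exists_corona_starAlgEquiv hΦ
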